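/- Theorem 1. Let $1<\alpha<2$ and let $u:\mathbb{R}\to\mathbb{R}$ be of class $C^{[\alpha]+3}(\mathbb{R})$ (here $[\alpha]=1$ is the integer part of $\alpha$), with all derivatives of order $0,1,\dots,[\alpha]+4$ in $L^1(\mathbb{R})$, where the derivative of order $[\alpha]+4$ is understood in the weak sense (i.e. $u^{([\alpha]+3)}$ is a primitive of a function in $L^1(\mathbb{R})$). Let $\kappa_{2,\ell}^{(\alpha)}$, $\ell=0,1,2,\dots$, be the power-series coefficients at $0$ of the generating function $$\widetilde W_2(z)=\Bigl(\tfrac{3\alpha-2}{2\alpha}-\tfrac{2(\alpha-1)}{\alpha}z+\tfrac{\alpha-2}{2\alpha}z^2\Bigr)^{\alpha}.$$ Then $\widetilde W_2(z)=\sum_{\ell=0}^{\infty}\kappa_{2,\ell}^{(\alpha)}z^{\ell}$ for all complex $|z|<1$ (principal branch of the power). For every $x\in\mathbb{R}$ the left Liouville derivative $${}_{RL}D^{\alpha}_{-\infty,x}u(x)=\frac{1}{\Gamma(2-\alpha)}\frac{d^2}{dx^2}\int_{-\infty}^{x}\frac{u(s)\,ds}{(x-s)^{\alpha-1}}$$ exists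 (the integral converges absolutely and is twice differentiable in $x$), for every $h>0$ the series $${}^{L}\mathcal{B}_2^{\alpha}u(x)=\frac1{h^{\alpha}}\sum_{\ell=0}^{\infty}\kappa_{2,\ell}^{(\alpha)}\,u\bigl(x-(\ell-1)h\bigr)$$ converges absolutely, and $${}_{RL}D^{\alpha}_{-\infty,x}u(x)={}^{L}\mathcal{B}_2^{\alpha}u(x)+\mathcal{O}(h^2)\qquad(h\to0^+),$$ uniformly in $x$: there is a constant $C$, independent of $x$ and $h$, such that $\bigl|{}_{RL}D^{\alpha}_{-\infty,x}u(x)-{}^{L}\mathcal{B}_2^{\alpha}u(x)\bigr|\le C h^2$ for all $h>0$ and all $x\in\mathbb{R}$. -/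

import Mathlib

open MeasureTheory Set

noncomputable section

/-- The improper integral `∫_{-∞}^x u(s) / (x - s)^(α - 1) ds`. -/
def liouvilleIntegral (α : ℝ) (u : ℝ → ℝ) (x : ℝ) : ℝ :=
  ∫ s in Iio x, u s / (x - s) ^ (α - 1)

/-- The left Liouville derivative of order `1 < α < 2`, that is, the left Riemann-Liouville
derivative with base point `-∞`:
`(1 / Γ(2 - α)) d²/dx² ∫_{-∞}^x u(s) / (x - s)^(α - 1) ds`. -/
def leftLiouvilleDeriv (α : ℝ) (u : ℝ → ℝ) (x : ℝ) : ℝ :=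
  1 / Real.Gamma (2 - α) * iteratedDeriv 2 (liouvilleIntegral α u) x

/-- The generating function on the real line. -/
def genW (α : ℝ) (z : ℝ) : ℝ :=
  ((3 * α - 2) / (2 * α) - 2 * (α - 1) / α * z + (α - 2) / (2 * α) * z ^ 2) ^ α

/-- The generating function on the complex plane (principal branch of the power). -/
def genWC (α : ℝ) (z : ℂ) : ℂ :=
  ((3 * (α : ℂ) - 2) / (2 * α) - 2 * ((α : ℂ) - 1) / α * z
    + ((α : ℂ) - 2) / (2 * α) * z ^ 2) ^ (α : ℂ)

/-- The power-series coefficients at `0` of the generating function. -/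
def kappa (α : ℝ) (l : ℕ) : ℝ :=
  iteratedDeriv l (genW α) 0 / (l.factorial : ℝ)

/-- The shifted difference operator
`h^(-α) ∑_{l ≥ 0} κ_l u(x - (l - 1) h)`. -/
def shiftedOp (α h : ℝ) (u : ℝ → ℝ) (x : ℝ) : ℝ :=
  1 / h ^ α * ∑' l : ℕ, kappa α l * u (x - ((l : ℝ) - 1) * h)

/-- `f` has a derivative in `L¹(ℝ)`: `f` is a primitive of an integrable function. Equivalently,
`f` is continuous with weak derivative in `L¹(ℝ)`, or locally absolutely continuous with
integrable almost-everywhere derivative. -/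
def HasDerivInL1 (f : ℝ → ℝ) : Prop :=
  ∃ g : ℝ → ℝ, Integrable g ∧ ∀ a b : ℝ, f b - f a = ∫ t in a..b, g t

end

/-! The base of the generating function `W` factors as `(1 - z) * (1 - r * (1 - z))` with `0 < r <
1/2`. So `W` is `(1 - z) ^ α` times a factor holomorphic on a disc of radius greater than one. The
Taylor coefficients of that factor decay geometrically, hence the decay of `κ` and of its partial
sums is that of the coefficients of powers of `1 - z`. The constants in `W` are such that `W (exp
(-x)) = exp (-x) * (x + O(x ^ 3)) ^ α`, which is the symbol `x ^ α` of the derivative, shifted by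
one step, to second order.

After rescaling to `h = 1`, the error is written with a Peano kernel. Summation against `κ` is
integration against the step function of its partial sums, so one more integration by parts gives
the error as `∫ K(s) v''(x + 1 - s) ds`, with `K(t) = (t - 1)₊ ^ (1 - α) / Γ(2 - α)` minus the
primitive of the step function. At integers that primitive takes the values of the iterated partial
sums, which agree with `n ^ (1 - α) / Γ(2 - α)` up to `O(n ^ (-1 - α))`
(`exists_abs_kappaSum₂_sub_rpow_le`), so `K` is integrable.

The Laplace transform of `K` is `(exp (-ε) * ε ^ α - W (exp (-ε))) / ε ^ 2`. By consistency
(`tendsto_symbol_defect`) it is `o(ε)`, so `K` and its first primitive both have integral zero.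
Hence the second primitive is bounded by `C * t₊ ^ (1 - α)` (`exists_abs_defectKernel₂_le`), and two
more integrations by parts express the error through the fourth derivative. The bound is
homogeneous, so undoing the scaling gives `h ^ (-α) * h ^ 4 * h ^ (α - 2) = h ^ 2`. The remaining
integral is bounded uniformly in `x` because the fourth derivative is both bounded and integrable.
-/

/-! ### Power series on the unit disc -/

/-- The power series with coefficients `a` sums to `f` on the open unit disc. -/
def DiscSeries (a : ℕ → ℂ) (f : ℂ → ℂ) : Prop :=
  ∀ z : ℂ, ‖z‖ < 1 → HasSum (fun n => a n * z ^ n) (f z)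

namespace DiscSeries

theorem congr {a : ℕ → ℂ} {f g : ℂ → ℂ} (h : DiscSeries a f)
    (hfg : ∀ z : ℂ, ‖z‖ < 1 → f z = g z) : DiscSeries a g :=
  fun z hz => hfg z hz ▸ h z hz

theorem add {a b : ℕ → ℂ} {f g : ℂ → ℂ} (ha : DiscSeries a f) (hb : DiscSeries b g) :
    DiscSeries (fun n => a n + b n) (fun z => f z + g z) := fun z hz => by
  simpa [add_mul] using (ha z hz).add (hb z hz)

theorem const_mul {a : ℕ → ℂ} {f : ℂ → ℂ} (c : ℂ) (ha : DiscSeries a f) :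
    DiscSeries (fun n => c * a n) (fun z => c * f z) := fun z hz => by
  simpa [mul_assoc] using (ha z hz).mul_left c

theorem mul {a b : ℕ → ℂ} {f g : ℂ → ℂ} (ha : DiscSeries a f) (hb : DiscSeries b g) :
    DiscSeries (fun n => ∑ k ∈ Finset.range (n + 1), a k * b (n - k)) (fun z => f z * g z) := by
  intro z hz
  have h := hasSum_sum_range_mul_of_summable_norm (ha z hz).summable.norm (hb z hz).summable.norm
  rw [(ha z hz).tsum_eq, (hb z hz).tsum_eq] at h
  refine h.congr_fun fun n => ?_
  rw [Finset.sum_mul]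
  refine Finset.sum_congr rfl fun k hk => ?_
  have : z ^ n = z ^ k * z ^ (n - k) := by
    rw [← pow_add, Nat.add_sub_cancel' (Finset.mem_range_succ_iff.1 hk)]
  rw [this]; ring

theorem hasFPowerSeriesAt {a : ℕ → ℂ} {f : ℂ → ℂ} (ha : DiscSeries a f) :
    HasFPowerSeriesAt f (FormalMultilinearSeries.ofScalars ℂ a) 0 := by
  rw [hasFPowerSeriesAt_iff]
  filter_upwards [Metric.ball_mem_nhds (0 : ℂ) one_pos] with z hz
  simpa [mul_comm] using ha z (by simpa using hz)

theorem unique {a b : ℕ → ℂ} {f : ℂ → ℂ} (ha : DiscSeries a f) (hb : DiscSeries b f) : a = b := by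
  have h := ha.hasFPowerSeriesAt.eq_formalMultilinearSeries hb.hasFPowerSeriesAt
  rwa [FormalMultilinearSeries.ofScalars_series_eq_iff] at h

theorem geom : DiscSeries (fun _ => 1) (fun z => (1 - z)⁻¹) := fun z hz => by
  simpa using hasSum_geometric_of_norm_lt_one hz

theorem partialSum {a : ℕ → ℂ} {f : ℂ → ℂ} (ha : DiscSeries a f) :
    DiscSeries (fun n => ∑ k ∈ Finset.range (n + 1), a k) (fun z => f z / (1 - z)) := by
  simpa [div_eq_mul_inv] using ha.mul geom

theorem of_differentiableOn {f : ℂ → ℂ} {r : ℝ} (hr : 1 ≤ r)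
    (hf : DifferentiableOn ℂ f (Metric.ball 0 r)) :
    DiscSeries (fun n => iteratedDeriv n f 0 / (n.factorial : ℂ)) f := fun z hz => by
  have := Complex.hasSum_taylorSeries_on_ball hf (z := z) (by simpa using hz.trans_le hr)
  refine this.congr_fun fun n => ?_
  simp; ring

/-- Taylor coefficients of a function that is holomorphic on a disc of radius greater than one
decay faster than any power. -/
theorem summable_weight_of_differentiableOn {f : ℂ → ℂ} {r : ℝ} (hr : 1 < r)
    (hf : DifferentiableOn ℂ f (Metric.ball 0 r)) (s : ℝ) :
    Summable fun n : ℕ => ‖iteratedDeriv n f 0 / (n.factorial : ℂ)‖ * ((n : ℝ) + 1) ^ s := by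
  -- The terms of the convergent series at an intermediate radius `ρ > 1` are bounded, so the
  -- coefficients are `O(ρ⁻¹ ^ n)`, which absorbs every power of `n`.
  obtain ⟨ρ, h1, h2⟩ := exists_between hr
  have hρ : 0 < ρ := by linarith
  have hs := Complex.hasSum_taylorSeries_on_ball hf (z := (ρ : ℂ))
    (by simpa [abs_of_pos hρ] using h2)
  obtain ⟨C, hC⟩ : ∃ C : ℝ, ∀ n : ℕ,
      ‖((n.factorial : ℂ))⁻¹ • ((ρ : ℂ) - 0) ^ n • iteratedDeriv n f 0‖ ≤ C := by
    obtain ⟨C, hC⟩ := hs.summable.tendsto_atTop_zero.norm.bddAbove_range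
    exact ⟨C, fun n => hC ⟨n, rfl⟩⟩
  obtain ⟨k, hk⟩ := exists_nat_ge s
  have hq : ‖ρ⁻¹‖ < 1 := by
    rw [norm_inv, Real.norm_of_nonneg hρ.le]; exact inv_lt_one_of_one_lt₀ h1
  have hsum : Summable fun n : ℕ => C * ρ * (((n + 1 : ℕ) : ℝ) ^ k * ρ⁻¹ ^ (n + 1)) :=
    Summable.mul_left _ ((summable_nat_add_iff (f := fun n : ℕ => (n : ℝ) ^ k * ρ⁻¹ ^ n) 1).2
      (summable_pow_mul_geometric_of_norm_lt_one k hq))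
  have hle : ∀ n : ℕ, ‖iteratedDeriv n f 0 / (n.factorial : ℂ)‖ * ((n : ℝ) + 1) ^ s ≤
      C * ρ * (((n + 1 : ℕ) : ℝ) ^ k * ρ⁻¹ ^ (n + 1)) := by
    intro n
    have h3 := hC n
    simp only [sub_zero, smul_eq_mul, norm_mul, norm_inv, norm_pow, Complex.norm_real,
      Real.norm_of_nonneg hρ.le] at h3
    have h4 : ‖iteratedDeriv n f 0 / (n.factorial : ℂ)‖ ≤ C * ρ⁻¹ ^ n := by
      rw [inv_pow, ← div_eq_mul_inv, le_div_iff₀ (by positivity)]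
      refine le_trans (le_of_eq ?_) h3
      rw [norm_div]; ring
    have h5 : ((n : ℝ) + 1) ^ s ≤ ((n + 1 : ℕ) : ℝ) ^ k := by
      rw [← Real.rpow_natCast]; push_cast
      exact Real.rpow_le_rpow_of_exponent_le (by linarith [n.cast_nonneg (α := ℝ)]) hk
    refine (mul_le_mul h4 h5 (by positivity) ((norm_nonneg _).trans h4)).trans (le_of_eq ?_)
    rw [pow_succ ρ⁻¹ n]
    generalize ρ⁻¹ ^ n = y
    generalize ((n + 1 : ℕ) : ℝ) ^ k = w
    field_simp
  exact Summable.of_nonneg_of_le (fun n => mul_nonneg (norm_nonneg _) (by positivity)) hle hsum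

end DiscSeries

/-! ### Coefficients of powers of `1 - z` -/

/-- Coefficients of `(1 - z) ^ s`. -/
noncomputable def oneSubCoeff (s : ℝ) (n : ℕ) : ℝ := ∏ j ∈ Finset.range n, ((j : ℝ) - s) / (j + 1)

theorem oneSubCoeff_succ (s : ℝ) (n : ℕ) :
    oneSubCoeff s (n + 1) = oneSubCoeff s n * (((n : ℝ) - s) / (n + 1)) := by
  unfold oneSubCoeff; rw [Finset.prod_range_succ]

theorem choose_eq_oneSubCoeff (s : ℝ) (n : ℕ) :
    (Ring.choose s n : ℝ) * (-1) ^ n = oneSubCoeff s n := by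
  have hf : ∀ n : ℕ, (n.factorial : ℝ) * (Ring.choose s n : ℝ) = (descPochhammer ℤ n).smeval s := by
    intro n; rw [Ring.descPochhammer_eq_factorial_smul_choose]; simp
  induction n with
  | zero => simp [oneSubCoeff]
  | succ n ih =>
    rw [oneSubCoeff_succ, ← ih]
    have h := hf (n + 1)
    rw [descPochhammer_succ_right, Polynomial.smeval_mul, ← hf n] at h
    simp [Polynomial.smeval_sub, Polynomial.smeval_X, Polynomial.smeval_natCast,
      Nat.factorial_succ] at h
    have hn : (n.factorial : ℝ) ≠ 0 := by positivity
    have hn1 : (n : ℝ) + 1 ≠ 0 := by positivity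
    have : Ring.choose s (n + 1) = Ring.choose s n * (s - n) / (n + 1) := by
      rw [eq_div_iff hn1]; apply mul_left_cancel₀ hn; linear_combination h
    rw [this, pow_succ]; field_simp; ring

theorem discSeries_oneSubCoeff (s : ℝ) :
    DiscSeries (fun n => (oneSubCoeff s n : ℂ)) (fun z => (1 - z) ^ (s : ℂ)) := by
  intro z hz
  have h := (Complex.one_add_cpow_hasFPowerSeriesOnBall_zero (a := (s : ℂ))).hasSum
    (y := -z) (by simpa [Metric.mem_eball, edist_zero_right, ← ofReal_norm] using hz)
  rw [zero_add, ← sub_eq_add_neg] at h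
  refine h.congr_fun fun n => ?_
  change (oneSubCoeff s n : ℂ) * z ^ n = _
  rw [← choose_eq_oneSubCoeff]
  simp [binomialSeries, neg_pow z, Complex.ofReal_choose]
  ring

/-- Both arguments lie in `(-π/2, π/2)`, so their sum does not cross the branch cut. -/
theorem cpow_mul_of_re_pos {x y : ℂ} (hx : 0 < x.re) (hy : 0 < y.re) (s : ℂ) :
    (x * y) ^ s = x ^ s * y ^ s := by
  have hx0 : x ≠ 0 := by rintro rfl; simp at hx
  have hy0 : y ≠ 0 := by rintro rfl; simp at hy
  have h1 := abs_lt.1 (Complex.abs_arg_lt_pi_div_two_iff.2 (Or.inl hx))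
  have h2 := abs_lt.1 (Complex.abs_arg_lt_pi_div_two_iff.2 (Or.inl hy))
  rw [Complex.cpow_def_of_ne_zero (mul_ne_zero hx0 hy0), Complex.cpow_def_of_ne_zero hx0,
    Complex.cpow_def_of_ne_zero hy0, Complex.log_mul hx0 hy0 ⟨by linarith, by linarith⟩, add_mul,
    Complex.exp_add]

/-- The weight is submultiplicative along the convolution, since `n + 1 ≤ (k + 1) * (n - k + 1)`. It
transfers polynomial decay from a singular factor to its product with a holomorphic one. -/
theorem exists_norm_cauchyProduct_le {a r : ℕ → ℂ} {s C : ℝ} (hs : 0 ≤ s)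
    (ha : ∀ n, ‖a n‖ ≤ C * ((n : ℝ) + 1) ^ (-s))
    (hr : Summable fun n : ℕ => ‖r n‖ * ((n : ℝ) + 1) ^ s) :
    ∃ D : ℝ, ∀ n : ℕ, ‖∑ k ∈ Finset.range (n + 1), a k * r (n - k)‖ ≤ D * ((n : ℝ) + 1) ^ (-s) := by
  have hC : 0 ≤ C := by simpa using (norm_nonneg _).trans (ha 0)
  refine ⟨C * ∑' n : ℕ, ‖r n‖ * ((n : ℝ) + 1) ^ s, fun n => ?_⟩
  have hp : (0 : ℝ) < ((n : ℝ) + 1) ^ s := by positivity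
  rw [Real.rpow_neg (by positivity), ← div_eq_mul_inv, le_div_iff₀ hp]
  calc _ ≤ (∑ k ∈ Finset.range (n + 1), ‖a k * r (n - k)‖) * ((n : ℝ) + 1) ^ s := by
        gcongr; exact norm_sum_le _ _
    _ ≤ ∑ k ∈ Finset.range (n + 1), C * (‖r (n - k)‖ * (((n - k : ℕ) : ℝ) + 1) ^ s) := by
        rw [Finset.sum_mul]
        refine Finset.sum_le_sum fun k hk => ?_
        have hkn := Finset.mem_range_succ_iff.1 hk
        have h1 : ((n : ℝ) + 1) ^ s ≤ ((k : ℝ) + 1) ^ s * (((n - k : ℕ) : ℝ) + 1) ^ s := by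
          rw [← Real.mul_rpow (by positivity) (by positivity)]
          refine Real.rpow_le_rpow (by positivity) ?_ hs
          have : (n : ℝ) = k + (n - k : ℕ) := by exact_mod_cast (Nat.add_sub_cancel' hkn).symm
          have h3 : (0 : ℝ) ≤ (k : ℝ) * (n - k : ℕ) := by positivity
          nlinarith
        have h2 : ‖a k‖ * ((k : ℝ) + 1) ^ s ≤ C := by
          have := ha k
          rwa [Real.rpow_neg (by positivity), ← div_eq_mul_inv, le_div_iff₀ (by positivity)] at this
        rw [norm_mul]
        calc _ ≤ ‖a k‖ * ‖r (n - k)‖ * (((k : ℝ) + 1) ^ s * (((n - k : ℕ) : ℝ) + 1) ^ s) := by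
              gcongr
          _ = (‖a k‖ * ((k : ℝ) + 1) ^ s) * (‖r (n - k)‖ * (((n - k : ℕ) : ℝ) + 1) ^ s) := by ring
          _ ≤ _ := by gcongr
    _ = C * ∑ k ∈ Finset.range (n + 1), ‖r k‖ * ((k : ℝ) + 1) ^ s := by
        rw [← Finset.mul_sum]
        congr 1
        exact Finset.sum_range_reflect (fun k : ℕ => ‖r k‖ * ((k : ℝ) + 1) ^ s) (n + 1)
    _ ≤ _ := by
        gcongr
        exact hr.sum_le_tsum _ fun _ _ => by positivity

/-- `|[zⁿ](1 - z) ^ s| = O(n ^ (-1 - s))` for `s ≥ 0`. -/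
theorem exists_norm_oneSubCoeff_le {s : ℝ} (hs : 0 ≤ s) :
    ∃ C : ℝ, ∀ n : ℕ, ‖(oneSubCoeff s n : ℂ)‖ ≤ C * ((n : ℝ) + 1) ^ (-(1 + s)) := by
  obtain ⟨N, hN⟩ := exists_nat_ge s
  have hmono : ∀ n, N ≤ n → |oneSubCoeff s (n + 1)| * ((n : ℝ) + 1) ^ (1 + s)
      ≤ |oneSubCoeff s n| * (n : ℝ) ^ (1 + s) := by
    intro n hn
    have hsn : s ≤ n := hN.trans (by exact_mod_cast hn)
    have hn1 : (0 : ℝ) < (n : ℝ) + 1 := by positivity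
    rw [oneSubCoeff_succ, abs_mul, mul_assoc]
    refine mul_le_mul_of_nonneg_left ?_ (abs_nonneg _)
    rw [abs_of_nonneg (div_nonneg (by linarith) hn1.le)]
    -- Bernoulli's inequality bounds the ratio `(n - s) / (n + 1)` of consecutive coefficients by
    -- `(n / (n + 1)) ^ (1 + s)`.
    have hb := one_add_mul_self_le_rpow_one_add (s := -1 / ((n : ℝ) + 1)) (p := 1 + s)
      (by rw [le_div_iff₀ hn1]; linarith [n.cast_nonneg (α := ℝ)]) (by linarith)
    have e1 : 1 + (1 + s) * (-1 / ((n : ℝ) + 1)) = (n - s) / (n + 1) := by field_simp; ring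
    have e2 : 1 + -1 / ((n : ℝ) + 1) = n / (n + 1) := by field_simp; ring
    rw [e1, e2, Real.div_rpow (by positivity) hn1.le, le_div_iff₀ (by positivity)] at hb
    exact hb
  have hb : ∀ n, N ≤ n → |oneSubCoeff s (n + 1)| * ((n : ℝ) + 1) ^ (1 + s)
      ≤ |oneSubCoeff s N| * (N : ℝ) ^ (1 + s) := by
    intro n hn
    induction n, hn using Nat.le_induction with
    | base => exact hmono N le_rfl
    | succ n hn ih =>
      refine (hmono (n + 1) (by omega)).trans ?_
      simpa using ih
  have key : ∃ D : ℝ, ∀ n, |oneSubCoeff s n| * ((n : ℝ) + 1) ^ (1 + s) ≤ D := by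
    let f : ℕ → ℝ := fun n => |oneSubCoeff s n| * ((n : ℝ) + 1) ^ (1 + s)
    refine ⟨∑ n ∈ Finset.range (N + 1), f n +
      2 ^ (1 + s) * (|oneSubCoeff s N| * (N : ℝ) ^ (1 + s)), fun n => ?_⟩
    have hf0 : ∀ n, 0 ≤ f n := fun n => by positivity
    have hA : 0 ≤ 2 ^ (1 + s) * (|oneSubCoeff s N| * (N : ℝ) ^ (1 + s)) := by positivity
    by_cases h : n < N + 1
    · have := Finset.single_le_sum (f := f) (fun i _ => hf0 i) (Finset.mem_range.2 h)
      exact this.trans (by linarith)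
    · obtain ⟨m, rfl⟩ : ∃ m, n = m + 1 := ⟨n - 1, by omega⟩
      have h1 := hb m (by omega)
      have h2 : (((m + 1 : ℕ) : ℝ) + 1) ^ (1 + s) ≤ 2 ^ (1 + s) * ((m : ℝ) + 1) ^ (1 + s) := by
        rw [← Real.mul_rpow (by positivity) (by positivity)]
        refine Real.rpow_le_rpow (by positivity) ?_ (by linarith)
        push_cast; linarith [m.cast_nonneg (α := ℝ)]
      have h3 : 0 ≤ ∑ n ∈ Finset.range (N + 1), f n := Finset.sum_nonneg fun i _ => hf0 i
      calc _ ≤ |oneSubCoeff s (m + 1)| * (2 ^ (1 + s) * ((m : ℝ) + 1) ^ (1 + s)) := by gcongr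
        _ = 2 ^ (1 + s) * (|oneSubCoeff s (m + 1)| * ((m : ℝ) + 1) ^ (1 + s)) := by ring
        _ ≤ 2 ^ (1 + s) * (|oneSubCoeff s N| * (N : ℝ) ^ (1 + s)) := by gcongr
        _ ≤ _ := by linarith
  obtain ⟨D, hD⟩ := key
  refine ⟨D, fun n => ?_⟩
  rw [Complex.norm_real, Real.norm_eq_abs, Real.rpow_neg (by positivity), ← div_eq_mul_inv,
    le_div_iff₀ (by positivity)]
  exact hD n

/-! ### Factorization of the generating function -/

/-- The zero of `genW α` other than `1`, in the variable `1 - z`, is `1 / rootInv α`. -/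
noncomputable def rootInv (α : ℝ) : ℝ := (2 - α) / (2 * α)

theorem rootInv_pos {α : ℝ} (h1 : 1 < α) (h2 : α < 2) : 0 < rootInv α :=
  div_pos (by linarith) (by linarith)

theorem rootInv_lt_half {α : ℝ} (h1 : 1 < α) : rootInv α < 1 / 2 := by
  unfold rootInv; rw [div_lt_div_iff₀ (by linarith) (by norm_num)]; linarith

/-- The factor of the generating function that is holomorphic beyond the closed unit disc. -/
noncomputable def outerFactor (α : ℝ) (z : ℂ) : ℂ := (1 - (rootInv α : ℂ) * (1 - z)) ^ (α : ℂ)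

theorem outerFactor_base_re_pos {α : ℝ} (h1 : 1 < α) (h2 : α < 2) {z : ℂ}
    (hz : ‖z‖ < (1 - rootInv α) / rootInv α) : 0 < (1 - (rootInv α : ℂ) * (1 - z)).re := by
  have he := rootInv_pos h1 h2
  rw [lt_div_iff₀ he] at hz
  have h := (abs_le.1 (Complex.abs_re_le_norm z)).1
  simp
  nlinarith

theorem one_lt_outerRadius {α : ℝ} (h1 : 1 < α) (h2 : α < 2) :
    1 < (1 - rootInv α) / rootInv α := by
  rw [lt_div_iff₀ (rootInv_pos h1 h2)]; linarith [rootInv_lt_half h1]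

theorem differentiableOn_outerFactor {α : ℝ} (h1 : 1 < α) (h2 : α < 2) :
    DifferentiableOn ℂ (outerFactor α) (Metric.ball 0 ((1 - rootInv α) / rootInv α)) := by
  intro z hz
  refine DifferentiableAt.differentiableWithinAt ?_
  unfold outerFactor
  refine DifferentiableAt.cpow (by fun_prop) (by fun_prop) (Or.inl ?_)
  exact outerFactor_base_re_pos h1 h2 (by simpa using hz)

theorem genWC_eq_mul {α : ℝ} (h1 : 1 < α) (h2 : α < 2) {z : ℂ} (hz : ‖z‖ < 1) :
    genWC α z = (1 - z) ^ (α : ℂ) * outerFactor α z := by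
  have hx : 0 < (1 - z).re := by
    have := (abs_le.1 (Complex.abs_re_le_norm z)).2
    simp; linarith
  have hy := outerFactor_base_re_pos h1 h2 (hz.trans (one_lt_outerRadius h1 h2))
  rw [outerFactor, ← cpow_mul_of_re_pos hx hy, genWC]
  congr 1
  have : (α : ℂ) ≠ 0 := by exact_mod_cast (by linarith : α ≠ 0)
  simp only [rootInv]; push_cast; field_simp; ring

/-- The second order remainder of `outerFactor α` at `1`. -/
noncomputable def outerRem (α : ℝ) : ℂ → ℂ := dslope (dslope (outerFactor α) 1) 1

theorem differentiableOn_outerRem {α : ℝ} (h1 : 1 < α) (h2 : α < 2) :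
    DifferentiableOn ℂ (outerRem α) (Metric.ball 0 ((1 - rootInv α) / rootInv α)) := by
  have hm : Metric.ball (0 : ℂ) ((1 - rootInv α) / rootInv α) ∈ nhds (1 : ℂ) :=
    Metric.isOpen_ball.mem_nhds (by simpa using one_lt_outerRadius h1 h2)
  rw [outerRem, Complex.differentiableOn_dslope hm, Complex.differentiableOn_dslope hm]
  exact differentiableOn_outerFactor h1 h2

/-- Taylor's formula at `1`, where the value is `1` and the derivative is `α * rootInv α = 1 - α /
2`. -/
theorem outerFactor_eq {α : ℝ} (h1 : 1 < α) (z : ℂ) :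
    outerFactor α z = 1 - (1 - (α : ℂ) / 2) * (1 - z) + (1 - z) ^ 2 * outerRem α z := by
  have e1 := sub_smul_dslope (outerFactor α) 1 z
  have e2 := sub_smul_dslope (dslope (outerFactor α) 1) 1 z
  have e3 : outerFactor α 1 = 1 := by simp [outerFactor]
  have e4 : dslope (outerFactor α) 1 1 = 1 - (α : ℂ) / 2 := by
    rw [dslope_same]
    have hd : HasDerivAt (fun z : ℂ => 1 - (rootInv α : ℂ) * (1 - z)) (rootInv α : ℂ) 1 := by
      simpa using (((hasDerivAt_id (1 : ℂ)).const_sub 1).const_mul (rootInv α : ℂ)).const_sub 1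
    have h := (hd.cpow_const (c := (α : ℂ)) (Or.inl (by simp))).deriv
    have h0 : (α : ℂ) ≠ 0 := by exact_mod_cast (by linarith : α ≠ 0)
    rw [show outerFactor α = fun z : ℂ => (1 - (rootInv α : ℂ) * (1 - z)) ^ (α : ℂ) from rfl, h]
    simp [rootInv]; field_simp
  simp only [smul_eq_mul, e3, e4] at e1 e2
  rw [outerRem]
  linear_combination (-1) * e1 - (z - 1) * e2

theorem genWC_ofReal {α : ℝ} (h1 : 1 < α) (h2 : α < 2) {x : ℝ} (hx : |x| < 1) :
    genWC α x = (genW α x : ℂ) := by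
  have hb := abs_lt.1 hx
  rw [genWC, genW, Complex.ofReal_cpow]
  · push_cast; rfl
  · have : (3 * α - 2) / (2 * α) - 2 * (α - 1) / α * x + (α - 2) / (2 * α) * x ^ 2
        = (1 - x) * (3 * α - 2 + (2 - α) * x) / (2 * α) := by field_simp; ring
    rw [this]
    refine div_nonneg (mul_nonneg (by linarith) ?_) (by linarith)
    nlinarith

/-- `kappa` comes from derivatives of the real function. On the real axis the complex Taylor series
has real sums, so its coefficients have zero imaginary part and their real parts are the real Taylor
coefficients. -/
theorem discSeries_kappa {α : ℝ} (h1 : 1 < α) (h2 : α < 2) :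
    DiscSeries (fun n => (kappa α n : ℂ)) (genWC α) := by
  have hd : DifferentiableOn ℂ (genWC α) (Metric.ball 0 1) := by
    refine DifferentiableOn.congr (f := fun z => (1 - z) ^ (α : ℂ) * outerFactor α z) ?_
      fun z hz => genWC_eq_mul h1 h2 (by simpa using hz)
    refine DifferentiableOn.mul (fun z hz => ?_) ((differentiableOn_outerFactor h1 h2).mono
      (Metric.ball_subset_ball (one_lt_outerRadius h1 h2).le))
    refine (DifferentiableAt.cpow (by fun_prop) (by fun_prop) (Or.inl ?_)).differentiableWithinAt
    have := (abs_le.1 (Complex.abs_re_le_norm z)).2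
    have hz' : ‖z‖ < 1 := by simpa using hz
    simp; linarith
  have ha := DiscSeries.of_differentiableOn le_rfl hd
  set a : ℕ → ℂ := fun n => iteratedDeriv n (genWC α) 0 / (n.factorial : ℂ)
  have hx : ∀ x : ℝ, |x| < 1 → HasSum (fun n => a n * (x : ℂ) ^ n) (genW α x : ℂ) := by
    intro x hx
    rw [← genWC_ofReal h1 h2 hx]
    exact ha x (by simpa using hx)
  have hball : ∀ᶠ x : ℝ in nhds 0, |x| < 1 := by
    filter_upwards [Metric.ball_mem_nhds (0 : ℝ) one_pos] with x hx
    simpa using hx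
  have hre : HasFPowerSeriesAt (genW α) (FormalMultilinearSeries.ofScalars ℝ fun n => (a n).re) 0 := by
    rw [hasFPowerSeriesAt_iff]
    filter_upwards [hball] with x hx1
    have := Complex.hasSum_re (hx x hx1)
    simp only [← Complex.ofReal_pow, Complex.re_mul_ofReal, Complex.ofReal_re] at this
    simpa [mul_comm] using this
  have him : HasFPowerSeriesAt (0 : ℝ → ℝ)
      (FormalMultilinearSeries.ofScalars ℝ fun n => (a n).im) 0 := by
    rw [hasFPowerSeriesAt_iff]
    filter_upwards [hball] with x hx1
    have := Complex.hasSum_im (hx x hx1)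
    simp only [← Complex.ofReal_pow, Complex.im_mul_ofReal, Complex.ofReal_im] at this
    simpa [mul_comm] using this
  have e1 := hre.eq_formalMultilinearSeries hre.analyticAt.hasFPowerSeriesAt
  have e2 := him.eq_zero
  rw [FormalMultilinearSeries.ofScalars_series_eq_iff] at e1
  have e3 : ∀ n, (a n).im = 0 := fun n => by
    have := congrArg (fun p => p.coeff n) e2
    rw [FormalMultilinearSeries.coeff_ofScalars] at this
    exact this.trans rfl
  have : (fun n => (kappa α n : ℂ)) = a := by
    funext n
    apply Complex.ext
    · have := congrFun e1 n
      simp [kappa, this]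
    · simp [e3]
  rw [this]; exact ha

/-! ### Decay of the coefficients and of their partial sums -/

/-- Partial sums of `kappa α`. -/
noncomputable def kappaSum (α : ℝ) (n : ℕ) : ℝ := ∑ k ∈ Finset.range (n + 1), kappa α k

/-- Iterated partial sums of `kappa α`. -/
noncomputable def kappaSum₂ (α : ℝ) (n : ℕ) : ℝ := ∑ k ∈ Finset.range (n + 1), kappaSum α k

theorem discSeries_kappaSum {α : ℝ} (h1 : 1 < α) (h2 : α < 2) :
    DiscSeries (fun n => (kappaSum α n : ℂ)) (fun z => genWC α z / (1 - z)) := by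
  simpa [kappaSum] using (discSeries_kappa h1 h2).partialSum

theorem discSeries_kappaSum₂ {α : ℝ} (h1 : 1 < α) (h2 : α < 2) :
    DiscSeries (fun n => (kappaSum₂ α n : ℂ)) (fun z => genWC α z / (1 - z) / (1 - z)) := by
  simpa [kappaSum₂] using (discSeries_kappaSum h1 h2).partialSum

theorem one_sub_ne_zero_of_norm_lt {z : ℂ} (hz : ‖z‖ < 1) : 1 - z ≠ 0 := by
  intro h
  rw [← sub_eq_zero.1 h] at hz
  simp at hz

theorem exists_abs_kappa_le {α : ℝ} (h1 : 1 < α) (h2 : α < 2) :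
    ∃ C : ℝ, ∀ n : ℕ, |kappa α n| ≤ C * ((n : ℝ) + 1) ^ (-(1 + α)) := by
  obtain ⟨C, hC⟩ := exists_norm_oneSubCoeff_le (s := α) (by linarith)
  obtain ⟨D, hD⟩ := exists_norm_cauchyProduct_le (by linarith) hC
    (DiscSeries.summable_weight_of_differentiableOn (one_lt_outerRadius h1 h2)
      (differentiableOn_outerFactor h1 h2) (1 + α))
  refine ⟨D, fun n => ?_⟩
  have h := (discSeries_kappa h1 h2).unique (((discSeries_oneSubCoeff α).mul
    (DiscSeries.of_differentiableOn (one_lt_outerRadius h1 h2).le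
      (differentiableOn_outerFactor h1 h2))).congr fun z hz => (genWC_eq_mul h1 h2 hz).symm)
  rw [← Real.norm_eq_abs, ← Complex.norm_real, congrFun h n]
  exact hD n

theorem summable_abs_kappa {α : ℝ} (h1 : 1 < α) (h2 : α < 2) : Summable fun n => |kappa α n| := by
  obtain ⟨C, hC⟩ := exists_abs_kappa_le h1 h2
  refine Summable.of_nonneg_of_le (fun _ => abs_nonneg _) hC (Summable.mul_left _ ?_)
  have := (summable_nat_add_iff 1).2 (Real.summable_nat_rpow.2 (by linarith : -(1 + α) < -1))
  simpa using this

/-- Dividing by `1 - z` lowers the exponent of the singular factor to `α - 1` and costs one power of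
`n`. -/
theorem exists_abs_kappaSum_le {α : ℝ} (h1 : 1 < α) (h2 : α < 2) :
    ∃ C : ℝ, ∀ n : ℕ, |kappaSum α n| ≤ C * ((n : ℝ) + 1) ^ (-α) := by
  obtain ⟨C, hC⟩ := exists_norm_oneSubCoeff_le (s := α - 1) (by linarith)
  simp only [add_sub_cancel] at hC
  obtain ⟨D, hD⟩ := exists_norm_cauchyProduct_le (by linarith) hC
    (DiscSeries.summable_weight_of_differentiableOn (one_lt_outerRadius h1 h2)
      (differentiableOn_outerFactor h1 h2) α)
  refine ⟨D, fun n => ?_⟩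
  have h := (discSeries_kappaSum h1 h2).unique (((discSeries_oneSubCoeff (α - 1)).mul
    (DiscSeries.of_differentiableOn (one_lt_outerRadius h1 h2).le
      (differentiableOn_outerFactor h1 h2))).congr fun z hz => by
        have := one_sub_ne_zero_of_norm_lt hz
        rw [genWC_eq_mul h1 h2 hz]; push_cast
        rw [Complex.cpow_sub _ _ this, Complex.cpow_one]; ring)
  rw [← Real.norm_eq_abs, ← Complex.norm_real, congrFun h n]
  exact hD n

/-- Coefficients of `(1 - z) ^ (α - 2) * (α / 2 + (1 - α / 2) * z)`. -/
noncomputable def mainCoeff (α : ℝ) (n : ℕ) : ℝ :=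
  α / 2 * oneSubCoeff (α - 2) n +
    (1 - α / 2) * (oneSubCoeff (α - 2) n - oneSubCoeff (α - 1) n)

/-- The constant and linear terms of `outerFactor α` at `1` produce `mainCoeff`. The remainder is
`(1 - z) ^ α` times a function holomorphic beyond the closed disc. -/
theorem exists_abs_kappaSum₂_sub_le {α : ℝ} (h1 : 1 < α) (h2 : α < 2) :
    ∃ C : ℝ, ∀ n : ℕ, |kappaSum₂ α n - mainCoeff α n| ≤ C * ((n : ℝ) + 1) ^ (-(1 + α)) := by
  obtain ⟨C, hC⟩ := exists_norm_oneSubCoeff_le (s := α) (by linarith)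
  obtain ⟨D, hD⟩ := exists_norm_cauchyProduct_le (by linarith) hC
    (DiscSeries.summable_weight_of_differentiableOn (one_lt_outerRadius h1 h2)
      (differentiableOn_outerRem h1 h2) (1 + α))
  refine ⟨D, fun n => ?_⟩
  have hm : DiscSeries (fun n => (mainCoeff α n : ℂ))
      (fun z => (α / 2 : ℂ) * (1 - z) ^ ((α - 2 : ℝ) : ℂ) + (1 - α / 2 : ℂ) *
        ((1 - z) ^ ((α - 2 : ℝ) : ℂ) + (-1) * (1 - z) ^ ((α - 1 : ℝ) : ℂ))) := by
    have := ((discSeries_oneSubCoeff (α - 2)).const_mul (α / 2 : ℂ)).add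
      (((discSeries_oneSubCoeff (α - 2)).add
        ((discSeries_oneSubCoeff (α - 1)).const_mul (-1))).const_mul (1 - α / 2 : ℂ))
    refine (congrArg (DiscSeries · _) (funext fun n => ?_)).mp this
    simp only [mainCoeff]; push_cast; ring
  have h := (discSeries_kappaSum₂ h1 h2).unique ((hm.add ((discSeries_oneSubCoeff α).mul
    (DiscSeries.of_differentiableOn (one_lt_outerRadius h1 h2).le
      (differentiableOn_outerRem h1 h2)))).congr fun z hz => by
        have := one_sub_ne_zero_of_norm_lt hz
        rw [genWC_eq_mul h1 h2 hz, outerFactor_eq h1]; push_cast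
        rw [Complex.cpow_sub _ _ this, Complex.cpow_sub _ _ this, Complex.cpow_one,
          Complex.cpow_ofNat]
        field_simp; ring)
  rw [← Real.norm_eq_abs, ← Complex.norm_real, Complex.ofReal_sub, congrFun h n]
  simpa using hD n

/-! ### Asymptotics of the iterated partial sums -/

theorem abs_le_mul_pow_of_hasDerivAt {f f' : ℝ → ℝ} {C : ℝ} {k : ℕ}
    (hf : ∀ x ∈ Icc (0 : ℝ) 1, HasDerivAt f (f' x) x) (h0 : f 0 = 0)
    (hb : ∀ x ∈ Icc (0 : ℝ) 1, |f' x| ≤ C * x ^ k) :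
    ∀ x ∈ Icc (0 : ℝ) 1, |f x| ≤ C * x ^ (k + 1) := by
  intro x hx
  have hC : 0 ≤ C := by simpa using (abs_nonneg _).trans (hb 1 (by simp))
  have := norm_image_sub_le_of_norm_deriv_le_segment' (f := f) (f' := f') (a := 0) (b := x)
    (C := C * x ^ k)
    (fun y hy => (hf y ⟨hy.1, hy.2.trans hx.2⟩).hasDerivWithinAt)
    (fun y hy => (hb y ⟨hy.1, hy.2.le.trans hx.2⟩).trans
      (by have := hy.1; have := hy.2; gcongr)) x ⟨hx.1, le_rfl⟩
  rw [h0] at this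
  simpa [pow_succ, mul_assoc] using this

theorem exists_abs_le_cube_of_hasDerivAt {f f₁ f₂ f₃ : ℝ → ℝ}
    (h1 : ∀ x ∈ Icc (0 : ℝ) 1, HasDerivAt f (f₁ x) x)
    (h2 : ∀ x ∈ Icc (0 : ℝ) 1, HasDerivAt f₁ (f₂ x) x)
    (h3 : ∀ x ∈ Icc (0 : ℝ) 1, HasDerivAt f₂ (f₃ x) x)
    (hc : ContinuousOn f₃ (Icc 0 1)) (e : f 0 = 0) (e1 : f₁ 0 = 0) (e2 : f₂ 0 = 0) :
    ∃ C : ℝ, ∀ x ∈ Icc (0 : ℝ) 1, |f x| ≤ C * x ^ 3 := by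
  obtain ⟨C, hC⟩ := isCompact_Icc.exists_bound_of_continuousOn hc
  exact ⟨C, abs_le_mul_pow_of_hasDerivAt h1 e (abs_le_mul_pow_of_hasDerivAt h2 e1
    (abs_le_mul_pow_of_hasDerivAt (k := 0) h3 e2 fun x hx => by simpa using hC x hx))⟩

theorem hasDerivAt_one_add_rpow (s : ℝ) {x : ℝ} (hx : 0 ≤ x) :
    HasDerivAt (fun x : ℝ => (1 + x) ^ s) (s * (1 + x) ^ (s - 1)) x := by
  simpa using ((hasDerivAt_id x).const_add 1).rpow_const (p := s) (Or.inl (by simp; linarith))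

theorem exists_abs_one_add_rpow_sub_le (s : ℝ) :
    ∃ C : ℝ, ∀ x ∈ Icc (0 : ℝ) 1,
      |(1 + x) ^ s - (1 + s * x + s * (s - 1) / 2 * x ^ 2)| ≤ C * x ^ 3 := by
  refine exists_abs_le_cube_of_hasDerivAt
    (f₁ := fun x => s * (1 + x) ^ (s - 1) - (s + s * (s - 1) * x))
    (f₂ := fun x => s * ((s - 1) * (1 + x) ^ (s - 1 - 1)) - s * (s - 1))
    (f₃ := fun x => s * ((s - 1) * ((s - 1 - 1) * (1 + x) ^ (s - 1 - 1 - 1))))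
    (fun x hx => ?_) (fun x hx => ?_) (fun x hx => ?_) ?_ (by simp) (by simp) (by simp)
  · refine ((hasDerivAt_one_add_rpow s hx.1).sub ((((hasDerivAt_id x).const_mul s).const_add 1).add
      (((hasDerivAt_id x).pow 2).const_mul (s * (s - 1) / 2)))).congr_deriv ?_
    simp; ring
  · refine (((hasDerivAt_one_add_rpow (s - 1) hx.1).const_mul s).sub
      (((hasDerivAt_id x).const_mul (s * (s - 1))).const_add s)).congr_deriv ?_
    simp
  · exact (((hasDerivAt_one_add_rpow (s - 1 - 1) hx.1).const_mul (s - 1)).const_mul s).sub_const _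
  · intro x hx
    exact ((((hasDerivAt_one_add_rpow (s - 1 - 1 - 1) hx.1).const_mul (s - 1 - 1)).const_mul
      (s - 1)).const_mul s).continuousAt.continuousWithinAt

/-- Coefficient form of `(z * d/dz - s) (1 - z) ^ s = -s * (1 - z) ^ (s - 1)`. -/
theorem oneSubCoeff_mul_sub (s : ℝ) (n : ℕ) :
    oneSubCoeff s n * (n - s) = -s * oneSubCoeff (s - 1) n := by
  induction n with
  | zero => simp [oneSubCoeff]
  | succ n ih =>
    rw [oneSubCoeff_succ, oneSubCoeff_succ]
    have : (n : ℝ) + 1 ≠ 0 := by positivity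
    push_cast
    field_simp
    linear_combination (n + 1 - s) * ih

-- Euler's limit formula for `Γ(1 - b)`: up to the factor `n / (n + 1 - b)`, the sequence is the
-- reciprocal of `Real.GammaSeq (1 - b)`.
open Filter Topology in
theorem tendsto_rpow_mul_oneSubCoeff {b : ℝ} (hb : b < 1) :
    Tendsto (fun n : ℕ => (n : ℝ) ^ b * oneSubCoeff (b - 1) n) atTop
      (𝓝 (1 / Real.Gamma (1 - b))) := by
  have hg := (Real.GammaSeq_tendsto_Gamma (1 - b)).inv₀ (Real.Gamma_pos_of_pos (by linarith)).ne'
  have hq : Tendsto (fun n : ℕ => (n : ℝ) / (n + (1 - b))) atTop (𝓝 1) :=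
    tendsto_natCast_div_add_atTop (1 - b)
  have h := hg.mul hq
  rw [mul_one, ← one_div] at h
  refine h.congr' ?_
  filter_upwards [eventually_ge_atTop 1] with n hn
  have hn0 : (0 : ℝ) < n := by exact_mod_cast hn
  have hprod : ∏ j ∈ Finset.range (n + 1), (1 - b + (j : ℝ)) =
      oneSubCoeff (b - 1) n * n.factorial * (n + (1 - b)) := by
    rw [Finset.prod_range_succ, add_comm (1 - b) (n : ℝ)]
    congr 1
    rw [oneSubCoeff, Finset.prod_div_distrib, ← Finset.prod_range_add_one_eq_factorial]
    push_cast
    rw [div_mul_cancel₀ _ (Finset.prod_ne_zero_iff.2 fun j _ => by positivity)]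
    exact Finset.prod_congr rfl fun j _ => by ring
  have h1 : (n : ℝ) + (1 - b) ≠ 0 := by linarith
  have hf : (n.factorial : ℝ) ≠ 0 := by positivity
  rw [Real.GammaSeq, hprod, Real.rpow_sub hn0, Real.rpow_one]
  have hp : (n : ℝ) ^ b ≠ 0 := by positivity
  field_simp

/-- A sequence whose increments are `O(n ^ (-3))` is within `O(n ^ (-2))` of its limit. -/
theorem exists_abs_sub_limit_le {q : ℕ → ℝ} {A C : ℝ} (hq : Filter.Tendsto q Filter.atTop (nhds A))
    (hC : ∀ n : ℕ, 1 ≤ n → |q (n + 1) - q n| ≤ C / (n : ℝ) ^ 3) :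
    ∀ n : ℕ, 1 ≤ n → |q n - A| ≤ 2 * C / (n : ℝ) ^ 2 := by
  intro n hn
  have hC0 : 0 ≤ C := by simpa using (abs_nonneg _).trans (hC 1 le_rfl)
  have key : ∀ m : ℕ, n ≤ m → |q m - q n| ≤ 2 * C / (n : ℝ) ^ 2 - 2 * C / (m : ℝ) ^ 2 := by
    intro m hm
    induction m, hm using Nat.le_induction with
    | base => simp
    | succ m hm ih =>
      have h1 := hC m (hn.trans hm)
      have hm1 : (1 : ℝ) ≤ m := by exact_mod_cast hn.trans hm
      have h2 : C / (m : ℝ) ^ 3 ≤ 2 * C / (m : ℝ) ^ 2 - 2 * C / ((m : ℝ) + 1) ^ 2 := by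
        rw [div_sub_div _ _ (by positivity) (by positivity), div_le_div_iff₀ (by positivity)
          (by positivity)]
        have : 0 ≤ C * (m : ℝ) ^ 2 * (3 * (m : ℝ) ^ 2 - 1) := by
          have : 0 ≤ 3 * (m : ℝ) ^ 2 - 1 := by nlinarith
          positivity
        nlinarith [mul_nonneg hC0 (pow_nonneg (zero_le_one.trans hm1) 3)]
      have h3 := abs_sub_le (q (m + 1)) (q m) (q n)
      push_cast
      linarith
  have h : |A - q n| ≤ 2 * C / (n : ℝ) ^ 2 := by
    refine le_of_tendsto (hq.sub_const (q n)).abs ?_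
    filter_upwards [Filter.eventually_ge_atTop n] with m hm
    exact (key m hm).trans (sub_le_self _ (by positivity))
  rwa [abs_sub_comm] at h

/-- With `b = α - 1`, the normalized sequence `q n = n ^ b * mainCoeff α n` converges to `1 / Γ(1 -
b)`. Its increments are `O(n ^ (-3))`, so its distance to the limit is `O(n ^ (-2))`. -/
theorem exists_abs_mainCoeff_sub_le {α : ℝ} (h1 : 1 < α) (h2 : α < 2) :
    ∃ C : ℝ, ∀ n : ℕ, 1 ≤ n →
      |mainCoeff α n - 1 / Real.Gamma (2 - α) * (n : ℝ) ^ (1 - α)| ≤ C * (n : ℝ) ^ (-(1 + α)) := by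
  obtain ⟨b, rfl⟩ : ∃ b, α = b + 1 := ⟨α - 1, by ring⟩
  have hb0 : 0 < b := by linarith
  have hb1 : b < 1 := by linarith
  set c : ℕ → ℝ := oneSubCoeff (b - 1) with hc
  -- This value of `γ` makes the `x ^ 2` coefficient vanish in `hpoly`. It removes the term of order
  -- `n ^ (-α)` from the expansion.
  set γ := b * (1 + b) / 2 with hγ
  have hlim := tendsto_rpow_mul_oneSubCoeff hb1
  obtain ⟨B, hB⟩ := hlim.abs.bddAbove_range
  have hB' : ∀ n : ℕ, |(n : ℝ) ^ b * c n| ≤ B := fun n => hB ⟨n, rfl⟩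
  have hmain : ∀ n : ℕ, 1 ≤ n → mainCoeff (b + 1) n = c n * ((n - γ) / (n - b)) := by
    intro n hn
    have hn' : (1 : ℝ) ≤ n := by exact_mod_cast hn
    have hnb : (n : ℝ) - b ≠ 0 := by linarith
    have h := oneSubCoeff_mul_sub b n
    have h' : oneSubCoeff b n = -b * c n / (n - b) := by rw [eq_div_iff hnb, h]
    rw [mainCoeff, show b + 1 - 2 = b - 1 by ring, show b + 1 - 1 = b by ring, h', ← hc]
    field_simp; ring
  set q : ℕ → ℝ := fun n => (n : ℝ) ^ b * mainCoeff (b + 1) n with hq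
  have hqlim : Filter.Tendsto q Filter.atTop (nhds (1 / Real.Gamma (1 - b))) := by
    have hr : Filter.Tendsto (fun n : ℕ => ((n : ℝ) - γ) / (n - b)) Filter.atTop (nhds 1) := by
      have := (tendsto_natCast_div_add_atTop (-b)).sub
        ((tendsto_inv_atTop_zero.comp (tendsto_natCast_atTop_atTop.atTop_add
          (tendsto_const_nhds (x := -b)))).const_mul γ)
      simp only [Function.comp_def, mul_zero, sub_zero] at this
      refine this.congr fun n => ?_
      rw [sub_div, div_eq_mul_inv γ, sub_eq_add_neg]; rfl
    have := hlim.mul hr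
    rw [mul_one] at this
    refine this.congr' ?_
    filter_upwards [Filter.eventually_ge_atTop 1] with n hn
    rw [hq]; simp only [hmain n hn]; ring
  obtain ⟨D, hD⟩ := exists_abs_one_add_rpow_sub_le b
  have hpoly : ∃ E : ℝ, ∀ x ∈ Icc (0 : ℝ) 1,
      |(1 + x) ^ b * ((1 + (1 - γ) * x) * (1 - b * x)) - (1 - γ * x) * (1 + x)| ≤ E * x ^ 3 := by
    let p : ℝ → ℝ := fun x => (1 + (1 - γ) * x) * (1 - b * x)
    -- With `(1 + x) ^ b` replaced by its quadratic Taylor polynomial, the difference is exactly `x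
    -- ^ 3 * r x`.
    let r : ℝ → ℝ := fun x => b * (-(1 - γ) * b) + b * (b - 1) / 2 * (1 - γ - b)
      + b * (b - 1) / 2 * (-(1 - γ) * b) * x
    have hp : ContinuousOn p (Icc 0 1) := by fun_prop
    have hr : ContinuousOn r (Icc 0 1) := by fun_prop
    obtain ⟨P, hP⟩ := isCompact_Icc.exists_bound_of_continuousOn hp
    obtain ⟨R, hR⟩ := isCompact_Icc.exists_bound_of_continuousOn hr
    refine ⟨D * P + R, fun x hx => ?_⟩
    have e : (1 + x) ^ b * ((1 + (1 - γ) * x) * (1 - b * x)) - (1 - γ * x) * (1 + x)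
        = ((1 + x) ^ b - (1 + b * x + b * (b - 1) / 2 * x ^ 2)) * p x + x ^ 3 * r x := by
      simp only [p, r, hγ]; ring
    rw [e]
    have hx3 : 0 ≤ x ^ 3 := pow_nonneg hx.1 3
    calc _ ≤ |(1 + x) ^ b - (1 + b * x + b * (b - 1) / 2 * x ^ 2)| * |p x| + x ^ 3 * |r x| := by
          refine (abs_add_le _ _).trans ?_
          rw [abs_mul _ (p x), abs_mul _ (r x), abs_of_nonneg hx3]
      _ ≤ (D * x ^ 3) * P + x ^ 3 * R := by
          refine add_le_add (mul_le_mul (hD x hx) (hP x hx) (abs_nonneg _)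
            ((abs_nonneg _).trans (hD x hx))) (mul_le_mul_of_nonneg_left (hR x hx) hx3)
      _ = _ := by ring
  obtain ⟨E, hE⟩ := hpoly
  have hE0 : 0 ≤ E := by simpa using (abs_nonneg _).trans (hE 1 (by simp))
  have hinc : ∀ n : ℕ, 1 ≤ n → |q (n + 1) - q n| ≤ B * (E / (1 - b)) / (n : ℝ) ^ 3 := by
    intro n hn
    have hn' : (1 : ℝ) ≤ n := by exact_mod_cast hn
    have hn0 : (0 : ℝ) < n := by linarith
    have hx : (1 / (n : ℝ)) ∈ Icc (0 : ℝ) 1 := ⟨by positivity, by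
      rw [div_le_one hn0]; exact hn'⟩
    have hEx := hE _ hx
    have hnb : (0 : ℝ) < (n : ℝ) - b := by linarith
    have hc1 : c (n + 1) = c n * ((n + 1 - b) / (n + 1)) := by
      rw [hc, oneSubCoeff_succ]; congr 2; ring
    have hpw : ((n : ℝ) + 1) ^ b = (n : ℝ) ^ b * (1 + 1 / (n : ℝ)) ^ b := by
      rw [← Real.mul_rpow hn0.le (by positivity)]; congr 1; field_simp
    have e : q (n + 1) - q n = ((n : ℝ) ^ b * c n) *
        (((1 + 1 / (n : ℝ)) ^ b * ((1 + (1 - γ) * (1 / (n : ℝ))) * (1 - b * (1 / (n : ℝ))))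
          - (1 - γ * (1 / (n : ℝ))) * (1 + 1 / (n : ℝ))) /
            ((1 + 1 / (n : ℝ)) * (1 - b * (1 / (n : ℝ))))) := by
      simp only [hq]
      rw [hmain n hn, hmain (n + 1) (by omega), hc1]
      push_cast
      rw [hpw]
      have a1 : (n : ℝ) + 1 - b ≠ 0 := by linarith
      have a2 : (n : ℝ) + 1 ≠ 0 := by linarith
      have a3 := hnb.ne'
      generalize (1 + 1 / (n : ℝ)) ^ b = T
      generalize (n : ℝ) ^ b = U
      field_simp
      ring
    have hden : 1 - b ≤ (1 + 1 / (n : ℝ)) * (1 - b * (1 / (n : ℝ))) := by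
      have h0 := hx.1
      have h1 := hx.2
      nlinarith [mul_nonneg h0 hb0.le, mul_nonneg h0 (by nlinarith : 0 ≤ 1 - b * (1 / (n : ℝ)))]
    rw [e, abs_mul, abs_div, mul_div_assoc]
    refine mul_le_mul (hB' n) ?_ (by positivity) ((abs_nonneg _).trans (hB' n))
    rw [abs_of_pos (lt_of_lt_of_le (by linarith) hden)]
    calc _ ≤ E * (1 / (n : ℝ)) ^ 3 / (1 - b) := by
          refine div_le_div₀ (by positivity) hEx (by linarith) hden
      _ = _ := by
          have : 1 - b ≠ 0 := by linarith
          field_simp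
  have hfin := exists_abs_sub_limit_le hqlim hinc
  refine ⟨2 * (B * (E / (1 - b))), fun n hn => ?_⟩
  have hn0 : (0 : ℝ) < n := by exact_mod_cast hn
  have hU : 0 < (n : ℝ) ^ b := by positivity
  have h := hfin n hn
  have e1 : (n : ℝ) ^ (1 - (b + 1)) = ((n : ℝ) ^ b)⁻¹ := by
    rw [← Real.rpow_neg hn0.le]; congr 1; ring
  have e2 : (n : ℝ) ^ (-(1 + (b + 1))) = ((n : ℝ) ^ b)⁻¹ / (n : ℝ) ^ 2 := by
    rw [← Real.rpow_neg hn0.le, ← Real.rpow_natCast, ← Real.rpow_sub hn0]; congr 1; push_cast; ring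
  have e3 : mainCoeff (b + 1) n - 1 / Real.Gamma (2 - (b + 1)) * ((n : ℝ) ^ b)⁻¹
      = (q n - 1 / Real.Gamma (1 - b)) * ((n : ℝ) ^ b)⁻¹ := by
    rw [show 2 - (b + 1) = 1 - b by ring]; simp only [hq]; field_simp
  rw [e1, e2, e3, abs_mul, abs_of_pos (inv_pos.2 hU)]
  calc _ ≤ 2 * (B * (E / (1 - b))) / (n : ℝ) ^ 2 * ((n : ℝ) ^ b)⁻¹ := by gcongr
    _ = _ := by ring

theorem exists_abs_kappaSum₂_sub_rpow_le {α : ℝ} (h1 : 1 < α) (h2 : α < 2) :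
    ∃ C : ℝ, ∀ n : ℕ, 1 ≤ n →
      |kappaSum₂ α n - 1 / Real.Gamma (2 - α) * (n : ℝ) ^ (1 - α)|
        ≤ C * (n : ℝ) ^ (-(1 + α)) := by
  obtain ⟨C, hC⟩ := exists_abs_kappaSum₂_sub_le h1 h2
  obtain ⟨D, hD⟩ := exists_abs_mainCoeff_sub_le h1 h2
  have hC0 : 0 ≤ C := by simpa using (abs_nonneg _).trans (hC 0)
  refine ⟨C + D, fun n hn => ?_⟩
  have hn0 : (0 : ℝ) < n := by exact_mod_cast hn
  have h3 : ((n : ℝ) + 1) ^ (-(1 + α)) ≤ (n : ℝ) ^ (-(1 + α)) :=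
    Real.rpow_le_rpow_of_nonpos hn0 (by linarith) (by linarith)
  calc _ ≤ _ := abs_sub_le _ (mainCoeff α n) _
    _ ≤ C * ((n : ℝ) + 1) ^ (-(1 + α)) + D * (n : ℝ) ^ (-(1 + α)) := add_le_add (hC n) (hD n hn)
    _ ≤ _ := by rw [add_mul]; gcongr

/-! ### Consistency of the symbol -/

open Filter Topology Asymptotics in
/-- Second order consistency of the shifted generating function at the origin. -/
theorem tendsto_symbol_defect {α : ℝ} (h1 : 1 < α) (h2 : α < 2) :
    Tendsto (fun x : ℝ => (Real.exp (-x) * x ^ α - genW α (Real.exp (-x))) / x ^ 3)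
      (𝓝[>] 0) (𝓝 0) := by
  have hα : α ≠ 0 := by linarith
  -- For `c = a`, this is `exp (x / α)` times the base of `genW α` at `exp (-x)`; the exponential
  -- accounts for the shift by one step. The family is closed under differentiation.
  let g : ℝ → ℝ → ℝ → ℝ → ℝ := fun c₀ c₁ c₂ x =>
    c₀ * Real.exp (1 / α * x) + c₁ * Real.exp ((1 / α - 1) * x) + c₂ * Real.exp ((1 / α - 2) * x)
  have hg : ∀ c₀ c₁ c₂ x, HasDerivAt (g c₀ c₁ c₂)
      (g (1 / α * c₀) ((1 / α - 1) * c₁) ((1 / α - 2) * c₂) x) x := by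
    intro c₀ c₁ c₂ x
    have he : ∀ k : ℝ, HasDerivAt (fun x => Real.exp (k * x)) (Real.exp (k * x) * k) x := fun k => by
      simpa using ((hasDerivAt_id x).const_mul k).exp
    refine ((((he (1 / α)).const_mul c₀).add ((he (1 / α - 1)).const_mul c₁)).add
      ((he (1 / α - 2)).const_mul c₂)).congr_deriv ?_
    simp only [g]; ring
  set a₀ := (3 * α - 2) / (2 * α) with ha₀
  set a₁ := -(2 * (α - 1) / α) with ha₁
  set a₂ := (α - 2) / (2 * α) with ha₂
  -- The three coefficients satisfy the three conditions `g 0 = 0`, `g' 0 = 1`, `g'' 0 = 0`.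
  obtain ⟨C, hC⟩ : ∃ C : ℝ, ∀ x ∈ Icc (0 : ℝ) 1, |g a₀ a₁ a₂ x - x| ≤ C * x ^ 3 := by
    refine exists_abs_le_cube_of_hasDerivAt
      (fun x _ => (hg a₀ a₁ a₂ x).sub (hasDerivAt_id x))
      (fun x _ => (hg _ _ _ x).sub_const 1) (fun x _ => hg _ _ _ x)
      (fun x _ => (hg _ _ _ x).continuousAt.continuousWithinAt) ?_ ?_ ?_
    · simp only [g, ha₀, ha₁, ha₂]; simp; field_simp; ring
    · simp only [g, ha₀, ha₁, ha₂]; simp; field_simp; ring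
    · simp only [g, ha₀, ha₁, ha₂]; simp; field_simp; ring
  have hIcc : ∀ᶠ x : ℝ in 𝓝[>] 0, x ∈ Ioc (0 : ℝ) 1 := Ioc_mem_nhdsGT one_pos
  have hO : (fun x => g a₀ a₁ a₂ x / x - 1) =O[𝓝[>] 0] fun x : ℝ => x ^ 2 := by
    refine IsBigO.of_bound C ?_
    filter_upwards [hIcc] with x hx
    have := hC x ⟨hx.1.le, hx.2⟩
    have hx0 := hx.1
    rw [div_sub_one hx0.ne', norm_div, Real.norm_eq_abs, Real.norm_of_nonneg hx0.le,
      Real.norm_of_nonneg (by positivity), div_le_iff₀ hx0]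
    linarith
  have hx2 : Tendsto (fun x : ℝ => x ^ 2) (𝓝[>] 0) (𝓝 0) := by
    have : Tendsto (fun x : ℝ => x ^ 2) (𝓝 0) (𝓝 (0 ^ 2)) := (continuous_pow 2).tendsto 0
    simpa using this.mono_left nhdsWithin_le_nhds
  have hlim1 : Tendsto (fun x => g a₀ a₁ a₂ x / x) (𝓝[>] 0) (𝓝 1) := by
    simpa using (hO.trans_tendsto hx2).add_const 1
  have hpow : (fun x => (g a₀ a₁ a₂ x / x) ^ α - 1) =O[𝓝[>] 0] fun x : ℝ => x ^ 2 := by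
    have hd := (Real.hasDerivAt_rpow_const (x := 1) (p := α) (Or.inl one_ne_zero)).isBigO_sub
    simpa [Function.comp_def] using (hd.comp_tendsto hlim1).trans hO
  have hx0 : Tendsto (fun x : ℝ => x ^ (α - 1)) (𝓝[>] 0) (𝓝 0) := by
    have := (Real.continuousAt_rpow_const 0 (α - 1) (Or.inr (by linarith))).tendsto
    rw [Real.zero_rpow (by linarith)] at this
    exact this.mono_left nhdsWithin_le_nhds
  have hexp : Tendsto (fun x : ℝ => Real.exp (-x)) (𝓝[>] 0) (𝓝 1) := by
    have : Tendsto (fun x : ℝ => Real.exp (-x)) (𝓝 0) (𝓝 (Real.exp (-0))) :=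
      (by fun_prop : Continuous fun x : ℝ => Real.exp (-x)).tendsto 0
    simpa using this.mono_left nhdsWithin_le_nhds
  have hfin : (fun x : ℝ => Real.exp (-x) * x ^ (α - 3) * ((g a₀ a₁ a₂ x / x) ^ α - 1))
      =O[𝓝[>] 0] fun x : ℝ => x ^ (α - 1) := by
    have h := ((hexp.isBigO_one ℝ).mul (isBigO_refl (fun x : ℝ => x ^ (α - 3)) (𝓝[>] 0))).mul hpow
    refine h.congr' EventuallyEq.rfl ?_
    filter_upwards [hIcc] with x hx
    rw [one_mul, ← Real.rpow_natCast, ← Real.rpow_add hx.1]; congr 1; push_cast; ring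
  have := (hfin.trans_tendsto hx0).neg
  rw [neg_zero] at this
  refine this.congr' ?_
  filter_upwards [hIcc, hlim1.eventually (lt_mem_nhds one_pos)] with x hx hgp
  have hx0 := hx.1
  have hg0 : 0 < g a₀ a₁ a₂ x := by
    have := mul_pos hgp hx0
    rwa [div_mul_cancel₀ _ hx0.ne'] at this
  have eW : genW α (Real.exp (-x)) = Real.exp (-x) * (g a₀ a₁ a₂ x) ^ α := by
    have hb : a₀ - 2 * (α - 1) / α * Real.exp (-x) + a₂ * Real.exp (-x) ^ 2
        = Real.exp (-(1 / α * x)) * g a₀ a₁ a₂ x := by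
      simp only [g, ha₁]
      have s1 : Real.exp ((1 / α - 1) * x) = Real.exp (1 / α * x) * Real.exp (-x) := by
        rw [← Real.exp_add]; congr 1; ring
      have s2 : Real.exp ((1 / α - 2) * x) = Real.exp (1 / α * x) * Real.exp (-x) ^ 2 := by
        rw [← Real.exp_nat_mul, ← Real.exp_add]; congr 1; push_cast; ring
      have s3 : Real.exp (-(1 / α * x)) * Real.exp (1 / α * x) = 1 := by
        rw [← Real.exp_add]; simp
      rw [s1, s2]
      linear_combination (-(a₀ - 2 * (α - 1) / α * Real.exp (-x) + a₂ * Real.exp (-x) ^ 2)) * s3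
    rw [genW, ← ha₀, ← ha₂, hb, Real.mul_rpow (Real.exp_pos _).le hg0.le, ← Real.exp_mul]
    congr 2; field_simp
  rw [eW, Real.div_rpow hg0.le hx0.le, Real.rpow_sub hx0]
  have : x ^ α ≠ 0 := by positivity
  have e3 : x ^ (3 : ℝ) = x ^ 3 := by exact_mod_cast Real.rpow_natCast x 3
  rw [e3]
  field_simp
  ring

open Filter Topology

/-! ### Primitives of kernels on the half-line -/

section Primitive

theorem continuous_integral_Iic {F : ℝ → ℝ} (hF : Integrable F) :
    Continuous fun t => ∫ s in Iic t, F s := by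
  have h : (fun t => ∫ s in Iic t, F s) = fun t => (∫ s in Iic 0, F s) + ∫ s in (0 : ℝ)..t, F s := by
    funext t
    rw [← intervalIntegral.integral_Iic_sub_Iic hF.integrableOn hF.integrableOn]; ring
  rw [h]
  exact continuous_const.add (intervalIntegral.continuous_primitive (fun _ _ => hF.intervalIntegrable) 0)

theorem abs_setIntegral_le {F : ℝ → ℝ} (hF : Integrable F) (A : Set ℝ) :
    |∫ s in A, F s| ≤ ∫ s, |F s| :=
  (abs_integral_le_integral_abs).trans
    (setIntegral_le_integral hF.abs (Eventually.of_forall fun _ => abs_nonneg _))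

theorem integral_Iic_eq_zero {F : ℝ → ℝ} (h0 : ∀ s ≤ 0, F s = 0) {t : ℝ} (ht : t ≤ 0) :
    ∫ s in Iic t, F s = 0 :=
  setIntegral_eq_zero_of_forall_eq_zero fun s hs => h0 s (le_trans hs ht)

/-- Integration by parts on the line, in the form of Fubini's theorem. -/
theorem integral_mul_integral_Ici {F g : ℝ → ℝ} (hF : Integrable F) (hg : Integrable g) :
    ∫ t, F t * ∫ s in Ici t, g s = ∫ s, (∫ t in Iic s, F t) * g s := by
  have hi : Integrable (Function.uncurry fun t s : ℝ => if t ≤ s then F t * g s else 0)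
      (volume.prod volume) := by
    have := (hF.mul_prod hg).indicator (measurableSet_le measurable_fst measurable_snd)
    refine this.congr (Eventually.of_forall fun p => ?_)
    by_cases h : p.1 ≤ p.2 <;> simp [Function.uncurry, indicator, h]
  have h := integral_integral_swap hi
  calc _ = ∫ t, ∫ s, (if t ≤ s then F t * g s else 0) := by
        congr 1; funext t
        rw [← integral_const_mul, ← integral_indicator measurableSet_Ici]
        rfl
    _ = _ := h
    _ = _ := by
        congr 1; funext s
        rw [← integral_mul_const, ← integral_indicator measurableSet_Iic]
        rfl

theorem integrable_of_rpow_tail {f : ℝ → ℝ} {C p : ℝ} (hp : 1 < p)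
    (hm : AEStronglyMeasurable f) (h0 : ∀ s ≤ 0, f s = 0) (hloc : IntegrableOn f (Ioc 0 2))
    (ht : ∀ s, 2 < s → |f s| ≤ C * s ^ (-p)) : Integrable f := by
  rw [← integrableOn_univ, ← Iic_union_Ioi (a := (0 : ℝ)), ← Ioc_union_Ioi_eq_Ioi (zero_le_two (α := ℝ))]
  refine IntegrableOn.union ?_ (hloc.union ?_)
  · exact integrableOn_zero.congr_fun (fun s hs => (h0 s hs).symm) measurableSet_Iic
  · have hi : IntegrableOn (fun s : ℝ => C * s ^ (-p)) (Ioi 2) :=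
      (integrableOn_Ioi_rpow_of_lt (by linarith) two_pos).const_mul C
    refine Integrable.mono' hi hm.restrict ?_
    filter_upwards [ae_restrict_mem measurableSet_Ioi] with s hs using ht s hs

/-- Zero total mass turns the primitive into minus a tail integral, which decays one power more
slowly than `F`. -/
theorem abs_integral_Iic_le_of_rpow_tail {F : ℝ → ℝ} {C p : ℝ} (hp : 1 < p) (hF : Integrable F)
    (hz : ∫ s, F s = 0) (ht : ∀ s, 2 < s → |F s| ≤ C * s ^ (-p)) {t : ℝ} (h2 : 2 < t) :
    |∫ s in Iic t, F s| ≤ C / (p - 1) * t ^ (-(p - 1)) := by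
  have h : ∫ s in Iic t, F s = -∫ s in Ioi t, F s := by
    have := setIntegral_union (Iic_disjoint_Ioi le_rfl) measurableSet_Ioi
      (hF.integrableOn (s := Iic t)) (hF.integrableOn (s := Ioi t))
    rw [Iic_union_Ioi, setIntegral_univ, hz] at this
    linarith
  have hi : IntegrableOn (fun s : ℝ => C * s ^ (-p)) (Ioi t) :=
    (integrableOn_Ioi_rpow_of_lt (by linarith) (by linarith)).const_mul C
  rw [h, abs_neg]
  refine (norm_integral_le_of_norm_le hi (f := F) ?_).trans (le_of_eq ?_)
  · filter_upwards [ae_restrict_mem measurableSet_Ioi] with s hs using ht s (h2.trans hs)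
  · rw [integral_const_mul, integral_Ioi_rpow_of_lt (by linarith) (by linarith),
      show -p + 1 = -(p - 1) by ring, neg_div_neg_eq]; ring

end Primitive

/-! ### Laplace transforms -/

section Laplace

/-- The exponential `exp (-ε t)` cut off to positive arguments. -/
noncomputable def expCut (ε : ℝ) : ℝ → ℝ := (Ioi 0).indicator fun t => Real.exp (-ε * t)

theorem integrable_expCut {ε : ℝ} (hε : 0 < ε) : Integrable (expCut ε) :=
  (integrable_indicator_iff measurableSet_Ioi).2 (integrableOn_exp_mul_Ioi (by linarith) 0)

theorem abs_expCut_le {ε : ℝ} (hε : 0 ≤ ε) (t : ℝ) : |expCut ε t| ≤ 1 := by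
  unfold expCut indicator
  split_ifs with h
  · rw [abs_of_pos (Real.exp_pos _), Real.exp_le_one_iff]
    have : 0 < t := h
    nlinarith
  · simp

theorem measurable_expCut (ε : ℝ) : Measurable (expCut ε) :=
  Measurable.indicator (by fun_prop) measurableSet_Ioi

theorem integral_Ioi_expCut {ε : ℝ} (hε : 0 < ε) {t : ℝ} (ht : 0 ≤ t) :
    ∫ s in Ioi t, expCut ε s = Real.exp (-ε * t) / ε := by
  rw [setIntegral_congr_fun (g := fun s => Real.exp (-ε * s)) measurableSet_Ioi]
  · rw [integral_exp_mul_Ioi (by linarith)]; rw [neg_div_neg_eq]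
  · intro s hs
    exact indicator_of_mem (mem_Ioi.2 (ht.trans_lt hs)) _

theorem integrable_mul_expCut {F : ℝ → ℝ} {ε : ℝ} (hε : 0 ≤ ε) (hF : Integrable F) :
    Integrable fun t => F t * expCut ε t :=
  hF.mul_bdd (c := 1) (measurable_expCut ε).aestronglyMeasurable
    (Eventually.of_forall fun t => abs_expCut_le hε t)

theorem laplace_eq_mul_laplace_primitive {F : ℝ → ℝ} {ε : ℝ} (hε : 0 < ε) (hF : Integrable F)
    (h0 : ∀ s ≤ 0, F s = 0) :
    ∫ t, F t * expCut ε t = ε * ∫ t, (∫ s in Iic t, F s) * expCut ε t := by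
  rw [← integral_mul_integral_Ici hF (integrable_expCut hε), ← integral_const_mul]
  congr 1; funext t
  rcases le_or_gt t 0 with ht | ht
  · simp [h0 t ht]
  · rw [integral_Ici_eq_integral_Ioi, integral_Ioi_expCut hε ht.le, expCut,
      indicator_of_mem (mem_Ioi.2 ht)]
    field_simp

/-- Recovers the total mass from the transform near zero, by dominated convergence. -/
theorem tendsto_laplace {F : ℝ → ℝ} (hF : Integrable F) (h0 : ∀ s ≤ 0, F s = 0) :
    Tendsto (fun ε => ∫ t, F t * expCut ε t) (𝓝[>] 0) (𝓝 (∫ t, F t)) := by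
  refine tendsto_integral_filter_of_dominated_convergence (fun t => |F t|) ?_ ?_ hF.abs ?_
  · filter_upwards [self_mem_nhdsWithin] with ε hε
    exact (integrable_mul_expCut (le_of_lt hε) hF).aestronglyMeasurable
  · filter_upwards [self_mem_nhdsWithin] with ε hε
    refine Eventually.of_forall fun t => ?_
    rw [norm_mul]
    exact mul_le_of_le_one_right (norm_nonneg _) (abs_expCut_le (le_of_lt hε) t)
  · refine Eventually.of_forall fun t => ?_
    rcases le_or_gt t 0 with ht | ht
    · simp [h0 t ht]
    · have : Tendsto (fun ε => F t * Real.exp (-ε * t)) (𝓝 0) (𝓝 (F t * Real.exp (-0 * t))) :=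
        (by fun_prop : Continuous fun ε => F t * Real.exp (-ε * t)).tendsto 0
      simp only [neg_zero, zero_mul, Real.exp_zero, mul_one] at this
      refine (this.mono_left nhdsWithin_le_nhds).congr fun ε => ?_
      rw [expCut, indicator_of_mem (mem_Ioi.2 ht)]

end Laplace

/-! ### The Peano kernel -/

section Kernel

/-- The step function `s ↦ ∑_{l < s} kappa α l`. -/
noncomputable def stepKernel (α s : ℝ) : ℝ := if 0 < s then kappaSum α (⌈s⌉₊ - 1) else 0

theorem stepKernel_of_nonpos (α : ℝ) {s : ℝ} (hs : s ≤ 0) : stepKernel α s = 0 :=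
  if_neg hs.not_gt

theorem stepKernel_of_mem_Ioc (α : ℝ) {s : ℝ} {n : ℕ} (hs : s ∈ Ioc (n : ℝ) (n + 1)) :
    stepKernel α s = kappaSum α n := by
  have h0 : 0 < s := (n.cast_nonneg (α := ℝ)).trans_lt hs.1
  have : ⌈s⌉₊ = n + 1 := by
    rw [Nat.ceil_eq_iff (by omega)]
    simpa using hs
  rw [stepKernel, if_pos h0, this, Nat.add_sub_cancel]

theorem measurable_stepKernel (α : ℝ) : Measurable (stepKernel α) :=
  Measurable.ite measurableSet_Ioi
    ((measurable_from_top (f := fun n : ℕ => kappaSum α (n - 1))).comp Nat.measurable_ceil)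
    measurable_const

theorem hasSum_stepKernel (α s : ℝ) :
    HasSum (fun l : ℕ => kappa α l * (Ioi (l : ℝ)).indicator 1 s) (stepKernel α s) := by
  rcases le_or_gt s 0 with hs | hs
  · rw [stepKernel_of_nonpos α hs]
    refine (hasSum_zero (α := ℝ) (β := ℕ)).congr_fun fun l => ?_
    have : s ∉ Ioi (l : ℝ) := fun h => absurd (hs.trans (l.cast_nonneg (α := ℝ))) (not_le.2 h)
    simp [indicator_of_notMem this]
  · rw [stepKernel, if_pos hs, kappaSum, Nat.sub_add_cancel (Nat.ceil_pos.2 hs)]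
    have h := hasSum_sum_of_ne_finset_zero (L := .unconditional ℕ) (s := Finset.range ⌈s⌉₊)
      (f := fun l : ℕ => kappa α l * (Ioi (l : ℝ)).indicator 1 s) fun l hl => by
        have : s ∉ Ioi (l : ℝ) := by
          rw [Finset.mem_range, Nat.lt_ceil] at hl; exact hl
        simp [indicator_of_notMem this]
    rw [Finset.sum_congr rfl fun l hl => ?_]
    · exact h
    have : s ∈ Ioi (l : ℝ) := Nat.lt_ceil.1 (Finset.mem_range.1 hl)
    simp [indicator_of_mem this]

theorem exists_abs_stepKernel_le {α : ℝ} (h1 : 1 < α) (h2 : α < 2) :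
    ∃ C : ℝ, (∀ s, |stepKernel α s| ≤ C) ∧ ∀ s, 0 < s → |stepKernel α s| ≤ C * s ^ (-α) := by
  obtain ⟨C, hC⟩ := exists_abs_kappaSum_le h1 h2
  have hC0 : 0 ≤ C := by simpa using (abs_nonneg _).trans (hC 0)
  have key : ∀ s, 0 < s → |stepKernel α s| ≤ C * (⌈s⌉₊ : ℝ) ^ (-α) := by
    intro s hs
    have := hC (⌈s⌉₊ - 1)
    rw [stepKernel, if_pos hs]
    rwa [Nat.cast_sub (Nat.one_le_ceil_iff.2 hs), Nat.cast_one, sub_add_cancel] at this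
  refine ⟨C, fun s => ?_, fun s hs => ?_⟩
  · rcases le_or_gt s 0 with hs | hs
    · simpa [stepKernel_of_nonpos α hs] using hC0
    · refine (key s hs).trans (mul_le_of_le_one_right hC0 ?_)
      exact Real.rpow_le_one_of_one_le_of_nonpos (by exact_mod_cast Nat.one_le_ceil_iff.2 hs)
        (by linarith)
  · refine (key s hs).trans (mul_le_mul_of_nonneg_left ?_ hC0)
    exact Real.rpow_le_rpow_of_nonpos hs (Nat.le_ceil s) (by linarith)

theorem integrable_stepKernel {α : ℝ} (h1 : 1 < α) (h2 : α < 2) : Integrable (stepKernel α) := by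
  obtain ⟨C, hC, hC'⟩ := exists_abs_stepKernel_le h1 h2
  refine integrable_of_rpow_tail h1 (measurable_stepKernel α).aestronglyMeasurable
    (fun s hs => stepKernel_of_nonpos α hs) ?_ fun s hs => hC' s (by linarith)
  exact Measure.integrableOn_of_bounded (M := C) (by simp)
    (measurable_stepKernel α).aestronglyMeasurable (Eventually.of_forall hC)

theorem hasSum_integral_stepKernel {α : ℝ} (h1 : 1 < α) (h2 : α < 2) {g : ℝ → ℝ}
    (hg : Integrable g) :
    HasSum (fun l : ℕ => kappa α l * ∫ s in Ioi (l : ℝ), g s) (∫ s, stepKernel α s * g s) := by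
  have e : ∀ (l : ℕ) (s : ℝ), kappa α l * (Ioi (l : ℝ)).indicator 1 s * g s
      = kappa α l * (Ioi (l : ℝ)).indicator g s := fun l s => by
    by_cases h : s ∈ Ioi (l : ℝ) <;> simp [indicator, h]
  have hi : ∀ l : ℕ, Integrable fun s => kappa α l * (Ioi (l : ℝ)).indicator 1 s * g s := fun l => by
    simp only [e]
    exact (hg.indicator measurableSet_Ioi).const_mul _
  have h := hasSum_integral_of_summable_integral_norm hi ?_
  · have e2 : ∫ s, stepKernel α s * g s
        = ∫ s, ∑' l : ℕ, kappa α l * (Ioi (l : ℝ)).indicator 1 s * g s := by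
      congr 1; funext s
      rw [((hasSum_stepKernel α s).mul_right (g s)).tsum_eq]
    rw [e2]
    refine h.congr_fun fun l => ?_
    simp only [e]
    rw [integral_const_mul, integral_indicator measurableSet_Ioi]
  · refine Summable.of_nonneg_of_le (fun l => integral_nonneg fun s => norm_nonneg _) (fun l => ?_)
      ((summable_abs_kappa h1 h2).mul_right (∫ s, |g s|))
    rw [← integral_const_mul]
    refine integral_mono (hi l).norm (hg.abs.const_mul _) fun s => ?_
    simp only [e, norm_mul, Real.norm_eq_abs]
    refine mul_le_mul_of_nonneg_left ?_ (abs_nonneg _)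
    rw [← Real.norm_eq_abs, ← Real.norm_eq_abs]
    exact norm_indicator_le_norm_self _ _

/-- The primitive of a step function is affine between consecutive integers. -/
theorem integral_Iic_stepKernel {α : ℝ} (h1 : 1 < α) (h2 : α < 2) (n : ℕ) {θ : ℝ}
    (hθ : θ ∈ Icc (0 : ℝ) 1) :
    ∫ s in Iic ((n : ℝ) + θ), stepKernel α s =
      (∫ s in Iic (n : ℝ), stepKernel α s) + θ * kappaSum α n := by
  have hS := integrable_stepKernel h1 h2
  have hu : Iic ((n : ℝ) + θ) = Iic (n : ℝ) ∪ Ioc (n : ℝ) (n + θ) :=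
    (Iic_union_Ioc_eq_Iic (by linarith [hθ.1])).symm
  have hd : Disjoint (Iic (n : ℝ)) (Ioc (n : ℝ) (n + θ)) := by
    rw [Set.disjoint_left]; exact fun x hx hx' => absurd hx'.1 (not_lt.2 hx)
  rw [hu, setIntegral_union hd measurableSet_Ioc hS.integrableOn hS.integrableOn]
  congr 1
  rw [setIntegral_congr_fun (g := fun _ => kappaSum α n) measurableSet_Ioc fun s hs =>
    stepKernel_of_mem_Ioc α ⟨hs.1, hs.2.trans (by linarith [hθ.2])⟩]
  simp [hθ.1]

theorem integral_Iic_stepKernel_succ {α : ℝ} (h1 : 1 < α) (h2 : α < 2) (n : ℕ) :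
    ∫ s in Iic ((n : ℝ) + 1), stepKernel α s = kappaSum₂ α n := by
  rw [integral_Iic_stepKernel h1 h2 n ⟨zero_le_one, le_rfl⟩, one_mul]
  induction n with
  | zero =>
    rw [integral_Iic_eq_zero (fun s hs => stepKernel_of_nonpos α hs) (by simp)]
    simp [kappaSum₂]
  | succ n ih =>
    push_cast
    rw [integral_Iic_stepKernel h1 h2 n ⟨zero_le_one, le_rfl⟩, one_mul, ih, kappaSum₂, kappaSum₂,
      Finset.sum_range_succ _ (n + 1)]

/-- The truncated power `t ↦ t₊ ^ (1 - α)`. -/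
noncomputable def powKernel (α : ℝ) : ℝ → ℝ := (Ioi 0).indicator fun t => t ^ (1 - α)

theorem measurable_powKernel (α : ℝ) : Measurable (powKernel α) :=
  Measurable.indicator (by fun_prop) measurableSet_Ioi

theorem integrableOn_powKernel {α : ℝ} (h2 : α < 2) : IntegrableOn (powKernel α) (Iic 1) := by
  have h := (intervalIntegral.intervalIntegrable_rpow' (a := 0) (b := 1)
    (by linarith : -1 < 1 - α)).1
  rw [← integrable_indicator_iff measurableSet_Ioc] at h
  rw [← integrable_indicator_iff measurableSet_Iic]
  refine h.congr (Eventually.of_forall fun t => ?_)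
  by_cases h0 : 0 < t <;> by_cases h1 : t ≤ 1 <;> simp [powKernel, indicator, h0, h1]

/-- Peano kernel of second order for the difference between the Liouville derivative and the
shifted difference operator with unit step. -/
noncomputable def defectKernel (α t : ℝ) : ℝ :=
  1 / Real.Gamma (2 - α) * powKernel α (t - 1) - ∫ s in Iic t, stepKernel α s

theorem defectKernel_of_nonpos (α : ℝ) {t : ℝ} (ht : t ≤ 0) : defectKernel α t = 0 := by
  rw [defectKernel, integral_Iic_eq_zero (fun s hs => stepKernel_of_nonpos α hs) ht, powKernel,
    indicator_of_notMem (by simp; linarith)]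
  simp

/-- Error of linear interpolation on a unit interval, which has the order of the second derivative.
Quadratic Taylor expansion in `1 / N` reduces it to `exists_abs_one_add_rpow_sub_le`. -/
theorem exists_abs_rpow_interp_le (b : ℝ) :
    ∃ C : ℝ, ∀ N : ℝ, 1 ≤ N → ∀ θ ∈ Icc (0 : ℝ) 1,
      |(N + θ) ^ b - ((1 - θ) * N ^ b + θ * (N + 1) ^ b)| ≤ C * N ^ (b - 2) := by
  obtain ⟨C, hC⟩ := exists_abs_one_add_rpow_sub_le b
  have hC0 : 0 ≤ C := by simpa using (abs_nonneg _).trans (hC 1 (by simp))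
  refine ⟨2 * C + |b * (b - 1) / 2|, fun N hN θ hθ => ?_⟩
  have hN0 : 0 < N := by linarith
  set x := 1 / N with hx
  have hx1 : x ∈ Icc (0 : ℝ) 1 := ⟨by positivity, by rw [hx, div_le_one hN0]; exact hN⟩
  have hθx : θ * x ∈ Icc (0 : ℝ) 1 :=
    ⟨mul_nonneg hθ.1 hx1.1, mul_le_one₀ hθ.2 hx1.1 hx1.2⟩
  have e1 : (N + θ) ^ b = N ^ b * (1 + θ * x) ^ b := by
    rw [← Real.mul_rpow hN0.le (by linarith [hθx.1])]; congr 1; rw [hx]; field_simp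
  have e2 : (N + 1) ^ b = N ^ b * (1 + x) ^ b := by
    rw [← Real.mul_rpow hN0.le (by linarith [hx1.1])]; congr 1; rw [hx]; field_simp
  have e3 : N ^ (b - 2) = N ^ b * x ^ 2 := by
    rw [Real.rpow_sub hN0, hx, div_pow, one_pow, mul_one_div]; norm_num
  have a1 := hC _ hθx
  have a2 := hC _ hx1
  set k := b * (b - 1) / 2
  have hx2 : 0 ≤ x ^ 2 := sq_nonneg x
  have b1 : |(1 + θ * x) ^ b - (1 + b * (θ * x) + k * (θ * x) ^ 2)| ≤ C * x ^ 2 := by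
    refine a1.trans (mul_le_mul_of_nonneg_left ?_ hC0)
    have : (θ * x) ^ 3 ≤ (θ * x) ^ 2 := pow_le_pow_of_le_one hθx.1 hθx.2 (by norm_num)
    refine this.trans ?_
    exact pow_le_pow_left₀ hθx.1 (mul_le_of_le_one_left hx1.1 hθ.2) 2
  have b2 : |θ * ((1 + x) ^ b - (1 + b * x + k * x ^ 2))| ≤ C * x ^ 2 := by
    rw [abs_mul, abs_of_nonneg hθ.1]
    refine (mul_le_of_le_one_left (abs_nonneg _) hθ.2).trans
      (a2.trans (mul_le_mul_of_nonneg_left ?_ hC0))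
    exact pow_le_pow_of_le_one hx1.1 hx1.2 (by norm_num)
  have b3 : |k * (θ ^ 2 - θ) * x ^ 2| ≤ |k| * x ^ 2 := by
    rw [abs_mul, abs_mul, abs_of_nonneg hx2]
    refine mul_le_mul_of_nonneg_right (mul_le_of_le_one_right (abs_nonneg _) ?_) hx2
    rw [abs_le]; constructor <;> nlinarith [hθ.1, hθ.2]
  have e : (N + θ) ^ b - ((1 - θ) * N ^ b + θ * (N + 1) ^ b) = N ^ b *
      (((1 + θ * x) ^ b - (1 + b * (θ * x) + k * (θ * x) ^ 2))
        - θ * ((1 + x) ^ b - (1 + b * x + k * x ^ 2)) + k * (θ ^ 2 - θ) * x ^ 2) := by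
    rw [e1, e2]; ring
  rw [e, e3, abs_mul, abs_of_pos (Real.rpow_pos_of_pos hN0 b)]
  have hp : 0 ≤ N ^ b := by positivity
  calc _ ≤ N ^ b * (C * x ^ 2 + C * x ^ 2 + |k| * x ^ 2) := by
        refine mul_le_mul_of_nonneg_left ?_ hp
        exact (abs_add_le _ _).trans (add_le_add ((abs_sub _ _).trans (add_le_add b1 b2)) b3)
    _ = _ := by ring

/-- The primitive of the step kernel interpolates `kappaSum₂` linearly, so the defect is an
interpolation error of the power plus the errors at the two nodes, all of order `N ^ (-1 - α)`. -/
theorem exists_abs_defectKernel_le {α : ℝ} (h1 : 1 < α) (h2 : α < 2) :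
    ∃ C : ℝ, ∀ t, 2 < t → |defectKernel α t| ≤ C * t ^ (-(1 + α)) := by
  obtain ⟨C, hC⟩ := exists_abs_kappaSum₂_sub_rpow_le h1 h2
  obtain ⟨D, hD⟩ := exists_abs_rpow_interp_le (1 - α)
  set A := 1 / Real.Gamma (2 - α) with hA
  have hC0 : 0 ≤ C := by simpa using (abs_nonneg _).trans (hC 1 le_rfl)
  have hD0 : 0 ≤ D := by simpa using (abs_nonneg _).trans (hD 1 le_rfl 0 (by simp))
  refine ⟨(|A| * D + 2 * C) * 3 ^ (1 + α), fun t ht => ?_⟩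
  -- The primitive at `N + 1` equals `kappaSum₂ α N`, and the shift in the power gives `t - 1 = N +
  -- θ`, so both refer to the node `N`. As `N ≥ 1`, `t ≤ N + 2 ≤ 3 * N`; hence the `3` in the
  -- constant.
  obtain ⟨N, hN⟩ : ∃ N : ℕ, ⌊t⌋₊ = N + 1 := ⟨⌊t⌋₊ - 1, by
    have : 2 ≤ ⌊t⌋₊ := Nat.le_floor (by exact_mod_cast ht.le)
    omega⟩
  have hN1 : 1 ≤ N := by
    have : 2 ≤ ⌊t⌋₊ := Nat.le_floor (by exact_mod_cast ht.le)
    omega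
  have hfl := Nat.floor_le (by linarith : 0 ≤ t)
  have hlt := Nat.lt_floor_add_one t
  rw [hN] at hfl hlt
  push_cast at hfl hlt
  set θ := t - (N + 1) with hθ
  have hθ1 : θ ∈ Icc (0 : ℝ) 1 := ⟨by linarith, by linarith⟩
  have hNr : (1 : ℝ) ≤ N := by exact_mod_cast hN1
  have hM : ∫ s in Iic t, stepKernel α s = (1 - θ) * kappaSum₂ α N + θ * kappaSum₂ α (N + 1) := by
    have e : t = ((N + 1 : ℕ) : ℝ) + θ := by push_cast; ring
    rw [e, integral_Iic_stepKernel h1 h2 (N + 1) hθ1]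
    push_cast
    rw [integral_Iic_stepKernel_succ h1 h2 N, kappaSum₂, kappaSum₂,
      Finset.sum_range_succ _ (N + 1)]
    ring
  have hP : powKernel α (t - 1) = ((N : ℝ) + θ) ^ (1 - α) := by
    rw [powKernel, indicator_of_mem (by simp; linarith)]
    congr 1; ring
  have hpw : ((N : ℝ) + 1) ^ (-(1 + α)) ≤ (N : ℝ) ^ (-(1 + α)) :=
    Real.rpow_le_rpow_of_nonpos (by linarith) (by linarith) (by linarith)
  have c1 := hC N hN1
  have c2 := (hC (N + 1) (by omega))
  push_cast at c2
  replace c2 := c2.trans (mul_le_mul_of_nonneg_left hpw hC0)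
  have c3 := hD N hNr θ hθ1
  rw [show 1 - α - 2 = -(1 + α) by ring] at c3
  set w := (N : ℝ) ^ (-(1 + α))
  have hw : w ≤ 3 ^ (1 + α) * t ^ (-(1 + α)) := by
    have e : (3 : ℝ) ^ (1 + α) * t ^ (-(1 + α)) = (t / 3) ^ (-(1 + α)) := by
      rw [Real.div_rpow (by linarith) (by norm_num), Real.rpow_neg (by norm_num : (0:ℝ) ≤ 3)]
      field_simp
    rw [e]
    exact Real.rpow_le_rpow_of_nonpos (by linarith) (by linarith) (by linarith)
  have e : defectKernel α t =
      A * (((N : ℝ) + θ) ^ (1 - α) - ((1 - θ) * (N : ℝ) ^ (1 - α) + θ * ((N : ℝ) + 1) ^ (1 - α)))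
      - ((1 - θ) * (kappaSum₂ α N - A * (N : ℝ) ^ (1 - α))
        + θ * (kappaSum₂ α (N + 1) - A * ((N : ℝ) + 1) ^ (1 - α))) := by
    rw [defectKernel, hM, hP]; ring
  have hw0 : 0 ≤ w := by positivity
  rw [e]
  calc _ ≤ |A| * (D * w) + (C * w + C * w) := by
        refine (abs_sub _ _).trans (add_le_add ?_ ((abs_add_le _ _).trans (add_le_add ?_ ?_)))
        · rw [abs_mul]; gcongr
        · rw [abs_mul, abs_of_nonneg (by linarith [hθ1.2])]
          exact (mul_le_of_le_one_left (abs_nonneg _) (by linarith [hθ1.1])).trans c1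
        · rw [abs_mul, abs_of_nonneg hθ1.1]
          exact (mul_le_of_le_one_left (abs_nonneg _) hθ1.2).trans c2
    _ = (|A| * D + 2 * C) * w := by ring
    _ ≤ (|A| * D + 2 * C) * (3 ^ (1 + α) * t ^ (-(1 + α))) := by gcongr
    _ = _ := by ring

theorem integrable_defectKernel {α : ℝ} (h1 : 1 < α) (h2 : α < 2) :
    Integrable (defectKernel α) := by
  obtain ⟨C, hC⟩ := exists_abs_defectKernel_le h1 h2
  have hM := continuous_integral_Iic (integrable_stepKernel h1 h2)
  refine integrable_of_rpow_tail (by linarith) ?_ (fun s hs => defectKernel_of_nonpos α hs) ?_ hC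
  · exact ((((measurable_powKernel α).comp (measurable_id.sub_const 1)).const_mul _).sub
      hM.measurable).aestronglyMeasurable
  · refine Integrable.sub (Integrable.const_mul ?_ _) (hM.integrableOn_Ioc)
    have h := ((integrable_indicator_iff measurableSet_Iic).2
      (integrableOn_powKernel h2)).comp_sub_right 1
    refine h.integrableOn.congr_fun (fun t ht => ?_) measurableSet_Ioc
    exact indicator_of_mem (by simp; linarith [ht.2]) _

/-- The jump of size `kappa α l` at `l` contributes `kappa α l * exp (-ε * l) / ε`, and these sum to
the generating function. -/
theorem laplace_stepKernel {α : ℝ} (h1 : 1 < α) (h2 : α < 2) {ε : ℝ} (hε : 0 < ε) :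
    ∫ t, stepKernel α t * expCut ε t = genW α (Real.exp (-ε)) / ε := by
  have hlt : |Real.exp (-ε)| < 1 := by
    rw [abs_of_pos (Real.exp_pos _), Real.exp_lt_one_iff]; linarith
  have hk := discSeries_kappa h1 h2 (Real.exp (-ε) : ℝ) (by rwa [Complex.norm_real])
  rw [genWC_ofReal h1 h2 hlt] at hk
  have hk' : HasSum (fun n => kappa α n * Real.exp (-ε) ^ n) (genW α (Real.exp (-ε))) := by
    rw [← Complex.hasSum_ofReal]
    refine hk.congr_fun fun n => ?_
    push_cast; rfl
  refine (hasSum_integral_stepKernel h1 h2 (integrable_expCut hε)).unique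
    ((hk'.div_const ε).congr_fun fun l => ?_)
  rw [integral_Ioi_expCut hε l.cast_nonneg, ← Real.exp_nat_mul, mul_div_assoc,
    show -ε * (l : ℝ) = l * -ε by ring]

theorem integral_shifted_powKernel_mul_expCut {α : ℝ} (h2 : α < 2) {ε : ℝ} (hε : 0 < ε) :
    ∫ t, powKernel α (t - 1) * expCut ε t
      = Real.exp (-ε) * (ε ^ (α - 2) * Real.Gamma (2 - α)) := by
  have h := Real.integral_rpow_mul_exp_neg_mul_Ioi (a := 2 - α) (by linarith) hε
  rw [← integral_add_right_eq_self _ 1]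
  have e : ∀ t, powKernel α (t + 1 - 1) * expCut ε (t + 1)
      = Real.exp (-ε) * (Ioi 0).indicator (fun t => t ^ (2 - α - 1) * Real.exp (-(ε * t))) t := by
    intro t
    rw [add_sub_cancel_right]
    by_cases ht : 0 < t
    · rw [powKernel, expCut, indicator_of_mem (mem_Ioi.2 ht), indicator_of_mem (mem_Ioi.2 ht),
        indicator_of_mem (mem_Ioi.2 (by linarith : 0 < t + 1)),
        show -ε * (t + 1) = -ε + -(ε * t) by ring, Real.exp_add, show 2 - α - 1 = 1 - α by ring]
      ring
    · simp [powKernel, ht]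
  simp only [e]
  rw [integral_const_mul, integral_indicator measurableSet_Ioi, h, one_div, Real.inv_rpow hε.le,
    ← Real.rpow_neg hε.le]
  congr 3; ring

theorem laplace_defectKernel {α : ℝ} (h1 : 1 < α) (h2 : α < 2) {ε : ℝ} (hε : 0 < ε) :
    ∫ t, defectKernel α t * expCut ε t
      = (Real.exp (-ε) * ε ^ α - genW α (Real.exp (-ε))) / ε ^ 2 := by
  have hS := integrable_stepKernel h1 h2
  have hK := integrable_defectKernel h1 h2
  have hMl := laplace_eq_mul_laplace_primitive hε hS fun s hs => stepKernel_of_nonpos α hs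
  rw [laplace_stepKernel h1 h2 hε] at hMl
  -- The primitive is bounded but not integrable, so integrability comes from the exponential.
  have hMi : Integrable fun t => (∫ s in Iic t, stepKernel α s) * expCut ε t :=
    (integrable_expCut hε).bdd_mul (c := ∫ s, |stepKernel α s|)
      (continuous_integral_Iic hS).aestronglyMeasurable
      (Eventually.of_forall fun t => abs_setIntegral_le hS _)
  have hadd := integral_add (integrable_mul_expCut hε.le hK) hMi
  have hΓ : Real.Gamma (2 - α) ≠ 0 := (Real.Gamma_pos_of_pos (by linarith)).ne'
  have e : ∫ t, defectKernel α t * expCut ε t + (∫ s in Iic t, stepKernel α s) * expCut ε t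
      = Real.exp (-ε) * ε ^ (α - 2) := by
    have : ∀ t, defectKernel α t * expCut ε t + (∫ s in Iic t, stepKernel α s) * expCut ε t
        = 1 / Real.Gamma (2 - α) * (powKernel α (t - 1) * expCut ε t) := fun t => by
      rw [defectKernel]; ring
    simp only [this]
    rw [integral_const_mul, integral_shifted_powKernel_mul_expCut h2 hε]
    field_simp
  rw [e] at hadd
  have e2 : ε ^ (α - 2) = ε ^ α / ε ^ 2 := by
    rw [Real.rpow_sub hε]; norm_num
  rw [e2] at hadd
  rw [← sub_eq_iff_eq_add.2 hadd]
  have : ∫ t, (∫ s in Iic t, stepKernel α s) * expCut ε t = genW α (Real.exp (-ε)) / ε ^ 2 := by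
    rw [eq_div_iff (by positivity)]
    rw [div_eq_iff hε.ne'] at hMl
    rw [hMl]; ring
  rw [this]; ring

/-! ### Vanishing moments and primitives of the Peano kernel -/

/-- First primitive of the defect kernel. -/
noncomputable def defectKernel₁ (α t : ℝ) : ℝ := ∫ s in Iic t, defectKernel α s

/-- Second primitive of the defect kernel. -/
noncomputable def defectKernel₂ (α t : ℝ) : ℝ := ∫ s in Iic t, defectKernel₁ α s

theorem defectKernel₁_of_nonpos (α : ℝ) {t : ℝ} (ht : t ≤ 0) : defectKernel₁ α t = 0 :=
  integral_Iic_eq_zero (fun _ hs => defectKernel_of_nonpos α hs) ht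

theorem defectKernel₂_of_nonpos (α : ℝ) {t : ℝ} (ht : t ≤ 0) : defectKernel₂ α t = 0 :=
  integral_Iic_eq_zero (fun _ hs => defectKernel₁_of_nonpos α hs) ht

/-- Each primitive divides the transform by `ε`, so this transform is the symbol defect over `ε ^
3`. -/
theorem tendsto_laplace_defectKernel₁ {α : ℝ} (h1 : 1 < α) (h2 : α < 2) :
    Tendsto (fun ε => ∫ t, defectKernel₁ α t * expCut ε t) (𝓝[>] 0) (𝓝 0) := by
  refine (tendsto_symbol_defect h1 h2).congr' ?_
  filter_upwards [self_mem_nhdsWithin] with ε hε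
  have hε : 0 < ε := hε
  have h := laplace_eq_mul_laplace_primitive hε (integrable_defectKernel h1 h2)
    fun s hs => defectKernel_of_nonpos α hs
  rw [laplace_defectKernel h1 h2 hε] at h
  have : ∫ t, defectKernel₁ α t * expCut ε t
      = (Real.exp (-ε) * ε ^ α - genW α (Real.exp (-ε))) / ε ^ 2 / ε := by
    rw [h, mul_div_cancel_left₀ _ hε.ne']; rfl
  rw [this, div_div, ← pow_succ]

/-- The transform is `ε` times that of the first primitive, hence tends to zero. This is what makes
the first primitive integrable. -/
theorem integral_defectKernel {α : ℝ} (h1 : 1 < α) (h2 : α < 2) : ∫ t, defectKernel α t = 0 := by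
  have hK := integrable_defectKernel h1 h2
  refine tendsto_nhds_unique (tendsto_laplace hK fun s hs => defectKernel_of_nonpos α hs) ?_
  have hid : Tendsto (fun ε : ℝ => ε) (𝓝[>] 0) (𝓝 0) := nhdsWithin_le_nhds
  have := hid.mul (tendsto_laplace_defectKernel₁ h1 h2)
  rw [mul_zero] at this
  refine this.congr' ?_
  filter_upwards [self_mem_nhdsWithin] with ε hε
  exact (laplace_eq_mul_laplace_primitive hε hK fun s hs => defectKernel_of_nonpos α hs).symm

theorem exists_abs_defectKernel₁_le {α : ℝ} (h1 : 1 < α) (h2 : α < 2) :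
    ∃ C : ℝ, ∀ t, 2 < t → |defectKernel₁ α t| ≤ C * t ^ (-α) := by
  obtain ⟨C, hC⟩ := exists_abs_defectKernel_le h1 h2
  refine ⟨C / α, fun t ht => (abs_integral_Iic_le_of_rpow_tail (by linarith)
    (integrable_defectKernel h1 h2) (integral_defectKernel h1 h2) hC ht).trans (le_of_eq ?_)⟩
  rw [add_sub_cancel_left]

theorem integrable_defectKernel₁ {α : ℝ} (h1 : 1 < α) (h2 : α < 2) :
    Integrable (defectKernel₁ α) := by
  obtain ⟨C, hC⟩ := exists_abs_defectKernel₁_le h1 h2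
  have hc : Continuous (defectKernel₁ α) := continuous_integral_Iic (integrable_defectKernel h1 h2)
  exact integrable_of_rpow_tail h1 hc.aestronglyMeasurable
    (fun s hs => defectKernel₁_of_nonpos α hs) hc.integrableOn_Ioc hC

theorem integral_defectKernel₁ {α : ℝ} (h1 : 1 < α) (h2 : α < 2) :
    ∫ t, defectKernel₁ α t = 0 :=
  tendsto_nhds_unique (tendsto_laplace (integrable_defectKernel₁ h1 h2)
    fun _ hs => defectKernel₁_of_nonpos α hs) (tendsto_laplace_defectKernel₁ h1 h2)

/-- For `t > 2` this is the tail bound for a kernel of zero mass. On `(0, 2]` the `L¹` norm of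
`defectKernel₁` suffices, as `t ^ (1 - α) ≥ 2 ^ (1 - α)` there. A homogeneous majorant is chosen for
the later scaling in `h`. -/
theorem exists_abs_defectKernel₂_le {α : ℝ} (h1 : 1 < α) (h2 : α < 2) :
    ∃ C : ℝ, 0 ≤ C ∧ ∀ t, |defectKernel₂ α t| ≤ C * powKernel α t := by
  obtain ⟨C, hC⟩ := exists_abs_defectKernel₁_le h1 h2
  have hK := integrable_defectKernel₁ h1 h2
  set B := ∫ s, |defectKernel₁ α s|
  have hB : 0 ≤ B := integral_nonneg fun _ => abs_nonneg _
  refine ⟨|C / (α - 1)| + B * 2 ^ (α - 1), by positivity, fun t => ?_⟩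
  rcases le_or_gt t 0 with h0 | h0
  · simp [defectKernel₂_of_nonpos α h0, powKernel, h0.not_gt]
  rw [powKernel, indicator_of_mem (mem_Ioi.2 h0)]
  have hp : 0 < t ^ (1 - α) := by positivity
  rcases le_or_gt t 2 with ht | ht
  · have h3 : 1 ≤ 2 ^ (α - 1) * t ^ (1 - α) := by
      have : (2 : ℝ) ^ (1 - α) ≤ t ^ (1 - α) := Real.rpow_le_rpow_of_nonpos h0 ht (by linarith)
      calc (1 : ℝ) = 2 ^ (α - 1) * 2 ^ (1 - α) := by
            rw [← Real.rpow_add two_pos]; simp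
        _ ≤ _ := by gcongr
    calc _ ≤ B := abs_setIntegral_le hK _
      _ ≤ B * (2 ^ (α - 1) * t ^ (1 - α)) := le_mul_of_one_le_right hB h3
      _ ≤ _ := by
        have : 0 ≤ |C / (α - 1)| * t ^ (1 - α) := by positivity
        linarith
  · have h := abs_integral_Iic_le_of_rpow_tail h1 hK (integral_defectKernel₁ h1 h2) hC ht
    rw [neg_sub] at h
    refine h.trans (mul_le_mul_of_nonneg_right ?_ hp.le)
    have : 0 ≤ B * 2 ^ (α - 1) := by positivity
    linarith [le_abs_self (C / (α - 1))]

end Kernel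

/-! ### Integral representation of the error -/

section Chain

theorem integral_Ici_comp_sub_left {v v' : ℝ → ℝ} (hd : ∀ x, HasDerivAt v (v' x) x)
    (hv : Integrable v) (hv' : Integrable v') (y t : ℝ) :
    ∫ s in Ici t, v' (y - s) = v (y - t) := by
  have h0 : Tendsto v atBot (𝓝 0) :=
    tendsto_zero_of_hasDerivAt_of_integrableOn_Iic (a := 0) (fun x _ => hd x)
      hv'.integrableOn hv.integrableOn
  have hlim : Tendsto (fun s => -v (y - s)) atTop (𝓝 0) := by
    have := (h0.comp (tendsto_atBot_add_const_left _ y tendsto_neg_atTop_atBot)).neg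
    rw [neg_zero] at this
    exact this.congr fun s => by simp [sub_eq_add_neg]
  have hder : ∀ s, HasDerivAt (fun s => -v (y - s)) (v' (y - s)) s := fun s => by
    simpa using ((hd (y - s)).comp_const_sub y s).fun_neg
  rw [integral_Ici_eq_integral_Ioi, integral_Ioi_of_hasDerivAt_of_tendsto
    (hder t).continuousAt.continuousWithinAt (fun s _ => hder s)
    (hv'.comp_sub_left y).integrableOn hlim]
  simp

theorem abs_le_integral_of_hasDerivAt {v v' : ℝ → ℝ} (hd : ∀ x, HasDerivAt v (v' x) x)
    (hv : Integrable v) (hv' : Integrable v') (x : ℝ) : |v x| ≤ ∫ s, |v' s| := by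
  have h := integral_Ici_comp_sub_left hd hv hv' x 0
  rw [sub_zero] at h
  rw [← h, ← integral_sub_left_eq_self (fun s => |v' s|) volume x]
  exact abs_setIntegral_le (hv'.comp_sub_left x) _

theorem integral_mul_comp_sub_left {F v v' : ℝ → ℝ} (hF : Integrable F)
    (hd : ∀ x, HasDerivAt v (v' x) x) (hv : Integrable v) (hv' : Integrable v') (y : ℝ) :
    ∫ t, F t * v (y - t) = ∫ s, (∫ t in Iic s, F t) * v' (y - s) := by
  rw [← integral_mul_integral_Ici hF (hv'.comp_sub_left y)]
  simp only [integral_Ici_comp_sub_left hd hv hv']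

/-- Representation of the difference between the Liouville derivative and the shifted difference
operator with unit step. -/
theorem defect_eq_integral {α : ℝ} (h1 : 1 < α) (h2 : α < 2) {v₀ v₁ v₂ v₃ v₄ : ℝ → ℝ}
    (hd₀ : ∀ x, HasDerivAt v₀ (v₁ x) x) (hd₁ : ∀ x, HasDerivAt v₁ (v₂ x) x)
    (hd₂ : ∀ x, HasDerivAt v₂ (v₃ x) x) (hd₃ : ∀ x, HasDerivAt v₃ (v₄ x) x)
    (hi₀ : Integrable v₀) (hi₁ : Integrable v₁) (hi₂ : Integrable v₂) (hi₃ : Integrable v₃)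
    (hi₄ : Integrable v₄) (x : ℝ) :
    1 / Real.Gamma (2 - α) * (∫ t, powKernel α t * v₂ (x - t))
        - ∑' l : ℕ, kappa α l * v₀ (x + 1 - l)
      = ∫ s, defectKernel₂ α s * v₄ (x + 1 - s) := by
  have hS := integrable_stepKernel h1 h2
  have hK := integrable_defectKernel h1 h2
  have hsum : ∑' l : ℕ, kappa α l * v₀ (x + 1 - l)
      = ∫ s, (∫ t in Iic s, stepKernel α t) * v₂ (x + 1 - s) := by
    rw [← integral_mul_comp_sub_left hS hd₁ hi₁ hi₂]
    refine HasSum.tsum_eq ?_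
    refine (hasSum_integral_stepKernel h1 h2 (hi₁.comp_sub_left (x + 1))).congr_fun fun l => ?_
    rw [← integral_Ici_comp_sub_left hd₀ hi₀ hi₁, integral_Ici_eq_integral_Ioi]
  have hMi : Integrable fun s => (∫ t in Iic s, stepKernel α t) * v₂ (x + 1 - s) :=
    (hi₂.comp_sub_left (x + 1)).bdd_mul (c := ∫ s, |stepKernel α s|)
      (continuous_integral_Iic hS).aestronglyMeasurable
      (Eventually.of_forall fun t => abs_setIntegral_le hS _)
  have hKi : Integrable fun s => defectKernel α s * v₂ (x + 1 - s) :=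
    hK.mul_bdd (c := ∫ s, |v₃ s|) (hi₂.comp_sub_left (x + 1)).aestronglyMeasurable
      (Eventually.of_forall fun t => abs_le_integral_of_hasDerivAt hd₂ hi₂ hi₃ _)
  have hadd := integral_add hKi hMi
  have hL : ∫ s, defectKernel α s * v₂ (x + 1 - s)
        + (∫ t in Iic s, stepKernel α t) * v₂ (x + 1 - s)
      = 1 / Real.Gamma (2 - α) * (∫ t, powKernel α t * v₂ (x - t)) := by
    -- Translation by `1` aligns the derivative at `x` with the series centred at `x + 1`.
    rw [← integral_sub_right_eq_self (fun t => powKernel α t * v₂ (x - t)) 1,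
      ← integral_const_mul]
    congr 1; funext s
    rw [defectKernel, show x - (s - 1) = x + 1 - s by ring]; ring
  rw [← hL, hsum, hadd, add_sub_cancel_right, integral_mul_comp_sub_left hK hd₂ hi₂ hi₃]
  exact integral_mul_comp_sub_left (integrable_defectKernel₁ h1 h2) hd₃ hi₃ hi₄ (x + 1)

end Chain

/-! ### The Liouville integral and its differentiation -/

section PowKernel

theorem powKernel_nonneg (α t : ℝ) : 0 ≤ powKernel α t :=
  indicator_nonneg (fun _ ht => Real.rpow_nonneg (le_of_lt ht) _) t

/-- The integrable singular part will be paired with sup bounds, and the part bounded by `1` with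
`L¹` norms. -/
theorem powKernel_le {α : ℝ} (h1 : 1 < α) (t : ℝ) :
    powKernel α t ≤ (Iic 1).indicator (powKernel α) t + 1 := by
  by_cases h : t ≤ 1
  · rw [indicator_of_mem (mem_Iic.2 h)]; linarith
  · rw [indicator_of_notMem (by simpa using h), zero_add, powKernel]
    push Not at h
    rw [indicator_of_mem (mem_Ioi.2 (by linarith))]
    exact Real.rpow_le_one_of_one_le_of_nonpos h.le (by linarith)

/-- The mass of `powKernel α` near its singularity. -/
noncomputable def powKernelMass (α : ℝ) : ℝ := ∫ t, (Iic 1).indicator (powKernel α) t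

theorem integrable_powKernel_mul {α B : ℝ} (h1 : 1 < α) (h2 : α < 2) {w : ℝ → ℝ}
    (hw : Integrable w) (hB : ∀ x, |w x| ≤ B) : Integrable fun t => powKernel α t * w t := by
  have hi := (integrable_indicator_iff measurableSet_Iic).2 (integrableOn_powKernel h2)
  refine Integrable.mono' ((hi.mul_const B).add hw.abs)
    ((measurable_powKernel α).aestronglyMeasurable.mul hw.aestronglyMeasurable)
    (Eventually.of_forall fun t => ?_)
  have h := powKernel_le h1 t
  have hp : 0 ≤ (Iic 1).indicator (powKernel α) t :=
    indicator_nonneg (fun t _ => powKernel_nonneg α t) t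
  rw [norm_mul, Real.norm_of_nonneg (powKernel_nonneg α t), Real.norm_eq_abs]
  calc _ ≤ ((Iic 1).indicator (powKernel α) t + 1) * |w t| := by gcongr
    _ = (Iic 1).indicator (powKernel α) t * |w t| + |w t| := by ring
    _ ≤ _ := add_le_add (mul_le_mul_of_nonneg_left (hB t) hp) le_rfl

theorem integral_powKernel_mul_abs_le {α B : ℝ} (h1 : 1 < α) (h2 : α < 2) {w : ℝ → ℝ}
    (hw : Integrable w) (hB : ∀ x, |w x| ≤ B) :
    ∫ t, powKernel α t * |w t| ≤ powKernelMass α * B + ∫ t, |w t| := by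
  have hi := (integrable_indicator_iff measurableSet_Iic).2 (integrableOn_powKernel h2)
  rw [powKernelMass, ← integral_mul_const, ← integral_add (hi.mul_const B) hw.abs]
  refine integral_mono (integrable_powKernel_mul h1 h2 hw.abs (by simpa using hB))
    ((hi.mul_const B).add hw.abs) fun t => ?_
  have h := powKernel_le h1 t
  have hp : 0 ≤ (Iic 1).indicator (powKernel α) t :=
    indicator_nonneg (fun t _ => powKernel_nonneg α t) t
  calc _ ≤ ((Iic 1).indicator (powKernel α) t + 1) * |w t| := by gcongr
    _ = (Iic 1).indicator (powKernel α) t * |w t| + |w t| := by ring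
    _ ≤ _ := add_le_add (mul_le_mul_of_nonneg_left (hB t) hp) le_rfl

/-- Homogeneity of degree `1 - α` together with the Jacobian `h⁻¹`. -/
theorem integral_powKernel_mul_comp_mul_left (α : ℝ) {h : ℝ} (hh : 0 < h) (f : ℝ → ℝ) :
    ∫ t, powKernel α t * f (h * t) = h ^ (α - 2) * ∫ t, powKernel α t * f t := by
  have hc := Measure.integral_comp_mul_left (fun t => powKernel α t * f t) h
  have hP : ∀ t, powKernel α (h * t) = h ^ (1 - α) * powKernel α t := fun t => by
    by_cases ht : 0 < t
    · rw [powKernel, indicator_of_mem (mem_Ioi.2 ht), indicator_of_mem (mem_Ioi.2 (by positivity)),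
        Real.mul_rpow hh.le ht.le]
    · have : ¬ 0 < h * t := fun h' => ht (pos_of_mul_pos_right h' hh.le)
      simp [powKernel, ht, this]
  simp only [hP, mul_assoc, integral_const_mul] at hc
  rw [abs_of_pos (inv_pos.2 hh), smul_eq_mul] at hc
  have e : h ^ (α - 2) = h⁻¹ / h ^ (1 - α) := by
    rw [← Real.rpow_neg_one, ← Real.rpow_sub hh]; congr 1; ring
  rw [e, div_mul_eq_mul_div, eq_div_iff (by positivity), ← hc, mul_comm]

theorem liouvilleIntegrand_eq (α : ℝ) (u : ℝ → ℝ) (x : ℝ) :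
    (Iio x).indicator (fun s => u s / (x - s) ^ (α - 1))
      = fun s => powKernel α (x - s) * u (x - (x - s)) := by
  funext s
  by_cases hs : s < x
  · rw [indicator_of_mem (mem_Iio.2 hs), powKernel, indicator_of_mem (mem_Ioi.2 (by linarith)),
      sub_sub_cancel, show 1 - α = -(α - 1) by ring, Real.rpow_neg (by linarith), div_eq_inv_mul]
  · rw [indicator_of_notMem (by simpa using hs), powKernel,
      indicator_of_notMem (by simpa using hs), zero_mul]

theorem liouvilleIntegral_eq (α : ℝ) (u : ℝ → ℝ) (x : ℝ) :
    liouvilleIntegral α u x = ∫ t, powKernel α t * u (x - t) := by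
  rw [liouvilleIntegral, ← integral_indicator measurableSet_Iio, liouvilleIntegrand_eq,
    integral_sub_left_eq_self (fun t => powKernel α t * u (x - t)) volume x]

theorem integrableOn_liouvilleIntegrand {α : ℝ} (h1 : 1 < α) (h2 : α < 2) {u : ℝ → ℝ} {B : ℝ}
    (hu : Integrable u) (hB : ∀ x, |u x| ≤ B) (x : ℝ) :
    IntegrableOn (fun s => u s / (x - s) ^ (α - 1)) (Iio x) := by
  rw [← integrable_indicator_iff measurableSet_Iio, liouvilleIntegrand_eq]
  exact (integrable_powKernel_mul h1 h2 (hu.comp_sub_left x) fun t => hB _).comp_sub_left x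

/-- An integrable majorant of a function near each point, when its derivative is integrable. -/
theorem exists_integrable_local_majorant {v v' : ℝ → ℝ} (hd : ∀ x, HasDerivAt v (v' x) x)
    (hv : Integrable v) (hv' : Integrable v') :
    ∃ G : ℝ → ℝ, Integrable G ∧ ∀ y δ : ℝ, |δ| ≤ 1 → |v (y + δ)| ≤ G y := by
  -- Convolving `|v'|` with `f` gives its integral over `[y - 1, y + 1]`, which bounds the local
  -- oscillation of `v` and is again integrable.
  let f : ℝ → ℝ := (Icc (-1) 1).indicator 1
  have hf : Integrable f :=
    (integrable_indicator_iff measurableSet_Icc).2 (integrableOn_const (by simp))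
  have hH := hf.integrable_convolution (ContinuousLinearMap.mul ℝ ℝ) hv'.abs
  refine ⟨fun y => |v y| + ∫ s, f s * |v' (y - s)|, hv.abs.add hH, fun y δ hδ => ?_⟩
  have e1 : ∫ s, f s * |v' (y - s)| = ∫ s in Icc (y - 1) (y + 1), |v' s| := by
    rw [← integral_indicator measurableSet_Icc,
      ← integral_sub_left_eq_self ((Icc (y - 1) (y + 1)).indicator fun s => |v' s|) volume y]
    congr 1; funext s
    by_cases hs : s ∈ Icc (-1 : ℝ) 1
    · rw [indicator_of_mem (show y - s ∈ Icc (y - 1) (y + 1) from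
        ⟨by linarith [hs.2], by linarith [hs.1]⟩)]
      simp [f, indicator_of_mem hs]
    · rw [indicator_of_notMem (show y - s ∉ Icc (y - 1) (y + 1) from fun h =>
        hs ⟨by linarith [h.2], by linarith [h.1]⟩)]
      simp [f, indicator_of_notMem hs]
  have e2 : ∫ s in y..(y + δ), v' s = v (y + δ) - v y :=
    intervalIntegral.integral_eq_sub_of_hasDerivAt (fun s _ => hd s) hv'.intervalIntegrable
  have e3 : |v (y + δ) - v y| ≤ ∫ s in Icc (y - 1) (y + 1), |v' s| := by
    rw [← e2]
    have hn : ‖∫ s in y..(y + δ), v' s‖ ≤ ∫ s in uIoc y (y + δ), ‖v' s‖ :=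
      intervalIntegral.norm_integral_le_integral_norm_uIoc
    refine hn.trans ?_
    refine setIntegral_mono_set hv'.norm.integrableOn (Eventually.of_forall fun _ => norm_nonneg _)
      (LE.le.eventuallyLE fun s hs => ?_)
    have hδ' := abs_le.1 hδ
    rw [uIoc, mem_Ioc, inf_lt_iff, le_sup_iff] at hs
    constructor
    · rcases hs.1 with h | h <;> linarith
    · rcases hs.2 with h | h <;> linarith
  have e4 : |v (y + δ)| ≤ |v y| + ∫ s, f s * |v' (y - s)| := by
    have := abs_sub_abs_le_abs_sub (v (y + δ)) (v y)
    rw [e1]; linarith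
  exact e4

/-- Differentiation under the integral sign. The majorant uses the sup of `w'` near the singularity
and a local majorant of `w'` elsewhere; both require `w''` to be integrable. -/
theorem hasDerivAt_integral_powKernel {α : ℝ} (h1 : 1 < α) (h2 : α < 2) {w w' w'' : ℝ → ℝ}
    (hd : ∀ x, HasDerivAt w (w' x) x) (hd' : ∀ x, HasDerivAt w' (w'' x) x)
    (hw : Integrable w) (hw' : Integrable w') (hw'' : Integrable w'') (x : ℝ) :
    HasDerivAt (fun x => ∫ t, powKernel α t * w (x - t)) (∫ t, powKernel α t * w' (x - t)) x := by
  obtain ⟨G, hG, hGb⟩ := exists_integrable_local_majorant hd' hw' hw''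
  have hi := (integrable_indicator_iff measurableSet_Iic).2 (integrableOn_powKernel h2)
  set B := ∫ s, |w'' s|
  have hB : ∀ x, |w' x| ≤ B := abs_le_integral_of_hasDerivAt hd' hw' hw''
  refine (hasDerivAt_integral_of_dominated_loc_of_deriv_le
    (F := fun x t => powKernel α t * w (x - t)) (F' := fun x t => powKernel α t * w' (x - t))
    (Metric.ball_mem_nhds x one_pos)
    (bound := fun t => (Iic 1).indicator (powKernel α) t * B + G (x - t))
    (Eventually.of_forall fun y => ?_) ?_ ?_ (Eventually.of_forall fun t y hy => ?_)
    ((hi.mul_const B).add (hG.comp_sub_left x)) (Eventually.of_forall fun t y _ => ?_)).2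
  · exact (measurable_powKernel α).aestronglyMeasurable.mul (hw.comp_sub_left y).aestronglyMeasurable
  · exact integrable_powKernel_mul h1 h2 (hw.comp_sub_left x)
      fun t => abs_le_integral_of_hasDerivAt hd hw hw' _
  · exact (measurable_powKernel α).aestronglyMeasurable.mul
      (hw'.comp_sub_left x).aestronglyMeasurable
  · have h := powKernel_le h1 t
    have hp : 0 ≤ (Iic 1).indicator (powKernel α) t :=
      indicator_nonneg (fun t _ => powKernel_nonneg α t) t
    have hg : |w' (y - t)| ≤ G (x - t) := by
      have := hGb (x - t) (y - x) (by rw [Metric.mem_ball, Real.dist_eq] at hy; exact hy.le)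
      rwa [show x - t + (y - x) = y - t by ring] at this
    rw [norm_mul, Real.norm_of_nonneg (powKernel_nonneg α t), Real.norm_eq_abs]
    calc _ ≤ ((Iic 1).indicator (powKernel α) t + 1) * |w' (y - t)| := by gcongr
      _ = (Iic 1).indicator (powKernel α) t * |w' (y - t)| + |w' (y - t)| := by ring
      _ ≤ _ := add_le_add (mul_le_mul_of_nonneg_left (hB _) hp) hg
  · exact ((hd (y - t)).comp_sub_const y t).const_mul _

end PowKernel

/-! ### Scaling and the main theorem -/

theorem HasDerivInL1.exists_abs_le {f : ℝ → ℝ} (hf : HasDerivInL1 f) : ∃ B : ℝ, ∀ x, |f x| ≤ B := by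
  obtain ⟨g, hg, hfg⟩ := hf
  refine ⟨|f 0| + ∫ s, |g s|, fun x => ?_⟩
  have h := hfg 0 x
  have hn : ‖∫ t in (0 : ℝ)..x, g t‖ ≤ ∫ t in uIoc 0 x, ‖g t‖ :=
    intervalIntegral.norm_integral_le_integral_norm_uIoc
  have h3 : |∫ t in (0 : ℝ)..x, g t| ≤ ∫ s, |g s| :=
    hn.trans (setIntegral_le_integral hg.abs (Eventually.of_forall fun _ => abs_nonneg _))
  rw [← h] at h3
  linarith [abs_sub_abs_le_abs_sub (f x) (f 0)]

theorem theorem1 (α : ℝ) (hα1 : 1 < α) (hα2 : α < 2) (u : ℝ → ℝ)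
    (hu : ContDiff ℝ ((⌊α⌋₊ + 3 : ℕ) : WithTop ℕ∞) u)
    (huL : ∀ k : ℕ, k ≤ ⌊α⌋₊ + 3 → Integrable (iteratedDeriv k u))
    (huTop : HasDerivInL1 (iteratedDeriv (⌊α⌋₊ + 3) u)) :
    -- the coefficients `kappa α l` expand the generating function on the whole unit disc
    (∀ z : ℂ, ‖z‖ < 1 → HasSum (fun l : ℕ => (kappa α l : ℂ) * z ^ l) (genWC α z)) ∧
    -- the left Liouville derivative exists everywhere
    (∀ x : ℝ, IntegrableOn (fun s : ℝ => u s / (x - s) ^ (α - 1)) (Iio x)) ∧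
    Differentiable ℝ (liouvilleIntegral α u) ∧
    Differentiable ℝ (deriv (liouvilleIntegral α u)) ∧
    -- the series defining the shifted operator converges absolutely
    (∀ h : ℝ, 0 < h → ∀ x : ℝ,
      Summable (fun l : ℕ => kappa α l * u (x - ((l : ℝ) - 1) * h))) ∧
    -- second-order approximation, uniformly in `x`
    (∃ C : ℝ, ∀ h : ℝ, 0 < h → ∀ x : ℝ,
      |leftLiouvilleDeriv α u x - shiftedOp α h u x| ≤ C * h ^ 2) := by
  have hfloor : ⌊α⌋₊ = 1 := by
    rw [Nat.floor_eq_iff (by linarith)]; norm_num; exact ⟨hα1.le, hα2⟩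
  rw [hfloor] at hu huL huTop
  have hd : ∀ k < 4, ∀ x, HasDerivAt (iteratedDeriv k u) (iteratedDeriv (k + 1) u x) x := by
    intro k hk x
    rw [iteratedDeriv_succ]
    exact (hu.differentiable_iteratedDeriv k (by exact_mod_cast hk) x).hasDerivAt
  have hi : ∀ k ≤ 4, Integrable (iteratedDeriv k u) := huL
  have e0 : iteratedDeriv 0 u = u := iteratedDeriv_zero
  have hd0 := hd 0 (by norm_num)
  have hi0 := hi 0 (by norm_num)
  rw [e0] at hd0 hi0
  have hu0 := abs_le_integral_of_hasDerivAt hd0 hi0 (hi 1 (by norm_num))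
  have hL : liouvilleIntegral α u = fun x => ∫ t, powKernel α t * u (x - t) :=
    funext (liouvilleIntegral_eq α u)
  have hL1 : ∀ x, HasDerivAt (liouvilleIntegral α u)
      (∫ t, powKernel α t * iteratedDeriv 1 u (x - t)) x := by
    rw [hL]
    exact hasDerivAt_integral_powKernel hα1 hα2 hd0 (hd 1 (by norm_num)) hi0 (hi 1 (by norm_num))
      (hi 2 (by norm_num))
  have hL2 : ∀ x, HasDerivAt (deriv (liouvilleIntegral α u))
      (∫ t, powKernel α t * iteratedDeriv 2 u (x - t)) x := by
    rw [funext fun x => (hL1 x).deriv]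
    exact hasDerivAt_integral_powKernel hα1 hα2 (hd 1 (by norm_num)) (hd 2 (by norm_num))
      (hi 1 (by norm_num)) (hi 2 (by norm_num)) (hi 3 (by norm_num))
  have hLd : ∀ x, leftLiouvilleDeriv α u x
      = 1 / Real.Gamma (2 - α) * ∫ t, powKernel α t * iteratedDeriv 2 u (x - t) := fun x => by
    rw [leftLiouvilleDeriv, iteratedDeriv_succ, iteratedDeriv_one, (hL2 x).deriv]
  refine ⟨discSeries_kappa hα1 hα2, integrableOn_liouvilleIntegrand hα1 hα2 hi0 hu0,
    fun x => (hL1 x).differentiableAt, fun x => (hL2 x).differentiableAt, fun h hh x => ?_, ?_⟩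
  · refine Summable.of_norm_bounded ((summable_abs_kappa hα1 hα2).mul_right (∫ s, |iteratedDeriv (0 + 1) u s|)) fun l => ?_
    rw [norm_mul, Real.norm_eq_abs, Real.norm_eq_abs]
    exact mul_le_mul_of_nonneg_left (hu0 _) (abs_nonneg _)
  -- The integrable weak fifth derivative serves only to bound the fourth derivative, which controls
  -- the integral near the kernel's singularity.
  obtain ⟨B, hB⟩ := huTop.exists_abs_le
  obtain ⟨C, hC0, hC⟩ := exists_abs_defectKernel₂_le hα1 hα2
  set w := iteratedDeriv 4 u with hw
  refine ⟨C * (powKernelMass α * B + ∫ t, |w t|), fun h hh x => ?_⟩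
  have hhα : 0 < h ^ α := by positivity
  -- These are the derivatives of `t ↦ u (h * t)`, which reduces the error to unit step at the point
  -- `x / h`.
  let v : ℕ → ℝ → ℝ := fun k t => h ^ k * iteratedDeriv k u (h * t)
  have hvd : ∀ k < 4, ∀ t, HasDerivAt (v k) (v (k + 1) t) t := by
    intro k hk t
    refine (((hd k hk (h * t)).comp t ((hasDerivAt_id t).const_mul h)).const_mul
      (h ^ k)).congr_deriv ?_
    simp only [v]; ring
  have hvi : ∀ k ≤ 4, Integrable (v k) := fun k hk =>
    ((hi k hk).comp_mul_left' hh.ne').const_mul _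
  have hid := defect_eq_integral hα1 hα2 (hvd 0 (by norm_num)) (hvd 1 (by norm_num))
    (hvd 2 (by norm_num)) (hvd 3 (by norm_num)) (hvi 0 (by norm_num)) (hvi 1 (by norm_num))
    (hvi 2 (by norm_num)) (hvi 3 (by norm_num)) (hvi 4 (by norm_num)) (x / h)
  have ea : ∫ t, powKernel α t * v 2 (x / h - t)
      = h ^ α * ∫ t, powKernel α t * iteratedDeriv 2 u (x - t) := by
    have e : ∀ t, powKernel α t * v 2 (x / h - t)
        = h ^ 2 * (powKernel α t * iteratedDeriv 2 u (x - h * t)) := fun t => by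
      simp only [v]
      rw [show h * (x / h - t) = x - h * t by field_simp]; ring
    simp only [e]
    rw [integral_const_mul, integral_powKernel_mul_comp_mul_left α hh
      (fun t => iteratedDeriv 2 u (x - t)), ← mul_assoc]
    congr 1
    rw [← Real.rpow_natCast, ← Real.rpow_add hh]; congr 1; push_cast; ring
  have eb : ∀ l : ℕ, v 0 (x / h + 1 - l) = u (x - ((l : ℝ) - 1) * h) := fun l => by
    simp only [v, e0, pow_zero, one_mul]
    congr 1; field_simp; ring
  have ec : ∀ s, v 4 (x / h + 1 - s) = h ^ 4 * w (x + h - h * s) := fun s => by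
    simp only [v]
    rw [show h * (x / h + 1 - s) = x + h - h * s by
      rw [mul_sub, mul_add, mul_div_cancel₀ _ hh.ne', mul_one]]
  simp only [ea, eb, ec] at hid
  have hE : leftLiouvilleDeriv α u x - shiftedOp α h u x
      = 1 / h ^ α * ∫ s, defectKernel₂ α s * (h ^ 4 * w (x + h - h * s)) := by
    rw [← hid, hLd, shiftedOp, mul_sub]
    congr 1
    field_simp
  have hwi : Integrable fun t => w (x + h - t) := (hi 4 le_rfl).comp_sub_left (x + h)
  have hmaj : Integrable fun s => C * h ^ 4 * (powKernel α s * |w (x + h - h * s)|) := by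
    refine Integrable.const_mul (integrable_powKernel_mul (B := B) hα1 hα2 ?_ fun s => ?_) _
    · exact (hwi.comp_mul_left' hh.ne').abs
    · rw [abs_abs]; exact hB _
  have hbound : |∫ s, defectKernel₂ α s * (h ^ 4 * w (x + h - h * s))|
      ≤ C * h ^ 4 * (h ^ (α - 2) * (powKernelMass α * B + ∫ t, |w t|)) := by
    refine (norm_integral_le_of_norm_le (f := fun s => defectKernel₂ α s * (h ^ 4 * w (x + h - h * s)))
      hmaj (Eventually.of_forall fun s => ?_)).trans ?_
    · rw [norm_mul, norm_mul, Real.norm_eq_abs, Real.norm_eq_abs, Real.norm_eq_abs,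
        abs_of_pos (by positivity : 0 < h ^ 4)]
      calc _ ≤ (C * powKernel α s) * (h ^ 4 * |w (x + h - h * s)|) := by
            gcongr; exact hC s
        _ = _ := by ring
    · rw [integral_const_mul, integral_powKernel_mul_comp_mul_left α hh (fun t => |w (x + h - t)|)]
      have h3 := integral_powKernel_mul_abs_le hα1 hα2 hwi (fun t => hB _)
      rw [integral_sub_left_eq_self (fun t => |w t|) volume (x + h)] at h3
      gcongr
  rw [hE, abs_mul, abs_of_pos (by positivity : 0 < 1 / h ^ α)]
  -- The powers of `h` combine exactly to `h ^ 2`, so no restriction to small `h` is needed.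
  calc _ ≤ 1 / h ^ α * (C * h ^ 4 * (h ^ (α - 2) * (powKernelMass α * B + ∫ t, |w t|))) := by
        gcongr
    _ = _ := by
        have : h ^ (α - 2) = h ^ α / h ^ 2 := by rw [Real.rpow_sub hh]; norm_num
        rw [this]; field_simp
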